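/- **Theorem.** Let $W,V$ and $\tilde W,\tilde V$ be complex-valued $C^\infty$ functions on $\mathbb{R}$ with $\operatorname{supp}W,\ \operatorname{supp}\tilde W\subseteq[-2,-1/2]\cup[1/2,2]$ and $\operatorname{supp}V,\ \operatorname{supp}\tilde V\subseteq[-1,1]$ (the case $\tilde W=W$, $\tilde V=V$ is allowed). Use the Fourier transform $\hat f(\xi)=\int_{\mathbb{R}^2}f(x)e^{-i\langle x,\xi\rangle}\,dx$ and put $A_a=\operatorname{diag}(a,\sqrt a)$ and $S_k=\begin{pmatrix}1&k\\0&1\end{pmatrix}$. *Shearlets.* Let $\psi$ be given by $\hat\psi(\xi_1,\xi_2)=W(\xi_1)V(\xi_2/\xi_1)$ (understood as $0$ for $\xi_1=0$). For integers $j\ge0$ and $|k|\le\lceil2^{j/2}\rceil$, $m\in\mathbb{Z}^2$ and $\iota\in\{1,2\}$ put $$\sigma_{(j,k,m,1)}(x)=2^{3j/4}\,\psi(S_kA_{2^j}x-m),\qquad \sigma_{(j,k,m,2)}(x_1,x_2)=\sigma_{(j,k,m,1)}(x_2,x_1).$$ *Curvelets.* For integers $j\ge0$ and $0\le\ell<2^{j/2}$,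 and $m\in\mathbb{Z}^2$, let $\theta_{j,\ell}=2\pi\ell/2^{j/2}$ and let $\gamma_{(j,\ell,m)}$ be given by $$\hat\gamma_{(j,\ell,m)}(\xi)=2^{-3j/4}\,\tilde W(r/2^j)\,\tilde V\bigl(2^{j/2}(\omega-\theta_{j,\ell})\bigr)\,e^{i\langle \rho_{\theta_{j,\ell}}A_{2^{-j}}m,\,\xi\rangle},$$ where $(r,\omega)$ are the polar coordinates of $\xi$, the angle $\omega-\theta_{j,\ell}$ is taken modulo $2\pi$ in $(-\pi,\pi]$, and $\rho_\theta$ is the counterclockwise rotation by $\theta$. Then all $\sigma_\eta$ and $\gamma_\mu$ lie in $L^2(\mathbb{R}^2)$, and for every $0<p\le1$ the cross-Gramian matrix $(\langle\sigma_\eta,\gamma_\mu\rangle)_{\eta,\mu}$, with $\eta=(j,k,m,\iota)$ and $\mu=(j,\ell,m)$ running over all these indices, satisfies $$\bigl\|(\langle\sigma_\eta,\gamma_\mu\rangle)_{\eta,\mu}\bigr\|_{Op,p}<\infty,$$ where $\langle f,g\rangle=\int f\bar g$ and, for a matrix $M=(m_{i,j})_{i,j}$, $$\|M\|_{Op,p}=\max\Bigl\{\Bigl(\sup_i\sum_j|m_{i,j}|^p\Bigr)^{1/p},\Bigl(\sup_j\sum_i|m_{i,j}|^p\Bigr)^{1/p}\Bigr\}.$$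 -/

import Mathlib

open MeasureTheory
open scoped ENNReal ComplexConjugate

noncomputable section

/-- The Euclidean plane `ℝ²`. -/
abbrev Plane : Type := EuclideanSpace ℝ (Fin 2)

/-- A real `2 × 2` matrix acting on the plane. -/
def matAct (M : Matrix (Fin 2) (Fin 2) ℝ) (x : Plane) : Plane :=
  WithLp.toLp 2 (M.mulVec x.ofLp)

/-- The lattice point `m ∈ ℤ²` as a vector of the plane. -/
def latticePoint (m : ℤ × ℤ) : Plane := !₂[(m.1 : ℝ), (m.2 : ℝ)]

/-- The inverse Fourier transform on `ℝ²`, for the convention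
`ĝ(ξ) = ∫ g(x) exp(-i⟨x, ξ⟩) dx`. -/
def invFourier (g : Plane → ℂ) (x : Plane) : ℂ :=
  ((((2 * Real.pi) ^ 2)⁻¹ : ℝ) : ℂ) *
    ∫ ξ : Plane, g ξ * Complex.exp (Complex.I * ((inner ℝ x ξ : ℝ) : ℂ))

/-- The parabolic scaling matrix `A_a = diag(a, √a)`. -/
def parabolicMatrix (a : ℝ) : Matrix (Fin 2) (Fin 2) ℝ := !![a, 0; 0, Real.sqrt a]

/-- The shear matrix `S_k`. -/
def shearMatrix (k : ℤ) : Matrix (Fin 2) (Fin 2) ℝ := !![1, (k : ℝ); 0, 1]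

/-- The matrix of the counterclockwise rotation by `θ`. -/
def rotationMatrix (θ : ℝ) : Matrix (Fin 2) (Fin 2) ℝ :=
  !![Real.cos θ, -Real.sin θ; Real.sin θ, Real.cos θ]

/-- Admissible radial window: smooth, supported in `[-2, -1/2] ∪ [1/2, 2]`. -/
structure IsRadialWindow (W : ℝ → ℂ) : Prop where
  smooth : ContDiff ℝ (⊤ : ℕ∞) W
  support_subset : tsupport W ⊆ Set.Icc (-2) (-1 / 2) ∪ Set.Icc (1 / 2) 2

/-- Admissible directional window: smooth, supported in `[-1, 1]`. -/
structure IsDirectionalWindow (V : ℝ → ℂ) : Prop where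
  smooth : ContDiff ℝ (⊤ : ℕ∞) V
  support_subset : tsupport V ⊆ Set.Icc (-1) 1

/-- Curvelet indices `μ = (j, ℓ, m)`: scale `j ≥ 0`, orientation `0 ≤ ℓ < 2^{j/2}`,
position `m ∈ ℤ²`. -/
structure CurveletIndex : Type where
  j : ℕ
  l : ℕ
  m : ℤ × ℤ
  l_lt : (l : ℝ) < (2 : ℝ) ^ ((j : ℝ) / 2)

/-- The orientation angle `θ_{j,ℓ} = 2πℓ / 2^{j/2}`. -/
def curveletAngle (j l : ℕ) : ℝ := 2 * Real.pi * l / (2 : ℝ) ^ ((j : ℝ) / 2)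

/-- The polar angle of `ξ` relative to the direction `θ`, as a representative in `(-π, π]`. -/
def angleFrom (θ : ℝ) (ξ : Plane) : ℝ :=
  ((Complex.arg ⟨ξ 0, ξ 1⟩ : Real.Angle) - (θ : Real.Angle)).toReal

/-- The Fourier transform of the curvelet `γ_μ`. -/
def curveletHat (W V : ℝ → ℂ) (μ : CurveletIndex) (ξ : Plane) : ℂ :=
  (((2 : ℝ) ^ (-(3 * (μ.j : ℝ) / 4)) : ℝ) : ℂ) *
    W (‖ξ‖ / (2 : ℝ) ^ μ.j) *
    V ((2 : ℝ) ^ ((μ.j : ℝ) / 2) * angleFrom (curveletAngle μ.j μ.l) ξ) *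
    Complex.exp (Complex.I *
      ((inner ℝ (matAct (rotationMatrix (curveletAngle μ.j μ.l))
          (matAct (parabolicMatrix ((2 : ℝ) ^ μ.j)⁻¹) (latticePoint μ.m))) ξ : ℝ) : ℂ))

/-- The curvelet `γ_μ`. -/
def curvelet (W V : ℝ → ℂ) (μ : CurveletIndex) : Plane → ℂ :=
  invFourier (curveletHat W V μ)

/-- Shearlet indices `η = (j, k, m, ι)`: scale `j ≥ 0`, orientation `|k| ≤ ⌈2^{j/2}⌉`,
position `m ∈ ℤ²`, cone `ι` (the value `0` is the horizontal cone `|ξ₂/ξ₁| ≤ 1`,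
the value `1` the vertical cone `|ξ₁/ξ₂| ≤ 1`). -/
structure ShearletIndex : Type where
  j : ℕ
  k : ℤ
  m : ℤ × ℤ
  cone : Fin 2
  abs_k_le : |k| ≤ ⌈(2 : ℝ) ^ ((j : ℝ) / 2)⌉

/-- The generating shearlet `ψ`, with `ψ̂(ξ₁, ξ₂) = W(ξ₁) V(ξ₂/ξ₁)`. -/
def shearletGenerator (W V : ℝ → ℂ) : Plane → ℂ :=
  invFourier fun ξ => W (ξ 0) * V (ξ 1 / ξ 0)

/-- The shearlet `2^{3j/4} ψ(S_k A_{2^j} x - m)` of the horizontal cone. -/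
def horizontalShearlet (W V : ℝ → ℂ) (j : ℕ) (k : ℤ) (m : ℤ × ℤ) (x : Plane) : ℂ :=
  (((2 : ℝ) ^ (3 * (j : ℝ) / 4) : ℝ) : ℂ) *
    shearletGenerator W V
      (matAct (shearMatrix k) (matAct (parabolicMatrix ((2 : ℝ) ^ j)) x) - latticePoint m)

/-- The shearlet `σ_η`; those of the vertical cone arise by exchanging the coordinates. -/
def shearlet (W V : ℝ → ℂ) (η : ShearletIndex) (x : Plane) : ℂ :=
  if η.cone = 0 then horizontalShearlet W V η.j η.k η.m x
  else horizontalShearlet W V η.j η.k η.m !₂[x 1, x 0]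

/-- The inner product `⟨f, g⟩ = ∫ f(x) conj(g(x)) dx` of `L²(ℝ²)`. -/
def l2Inner (f g : Plane → ℂ) : ℂ := ∫ x : Plane, f x * conj (g x)

/-- The `‖·‖_{Op,p}`-norm, with values in `[0, ∞]`, of a matrix. -/
def opNormP {I J : Type*} (p : ℝ) (M : I → J → ℂ) : ℝ≥0∞ :=
  max ((⨆ i, ∑' j, ‖M i j‖ₑ ^ p) ^ (1 / p)) ((⨆ j, ∑' i, ‖M i j‖ₑ ^ p) ^ (1 / p))

end

section

open scoped FourierTransform SchwartzMap ContDiff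

/-! Both systems consist of affine copies of well-behaved profiles. A shearlet is `2^{3j/4} f(Bx +
t)` with one fixed Schwartz function `f`. A curvelet is `2^{3j'/4} g_e(B'x + t')` with `e =
2^{-j'/2}`, where the frequency profile of `g_e` is a slice of a single smooth compactly supported
function of `(e, ζ)`. This function stays smooth through `e = 0`, so the `g_e` decay rapidly with
constants independent of the scale (`curveletProfile_eq`, `exists_uniform_decay_invFourier`).

Everything then depends on the transition matrix `T` with `T B = B'`. By Plancherel an entry
vanishes unless `Tᵀ` carries some point of the curvelet profile's support into the shearlet
profile's support. One such point already forces comparable scales, bounded entries of `T`, and an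
orientation mismatch of order `2^{-j/2}` (`crossMatrix_bounds`). In that case a change of variables
bounds the entry by `C (1 + ‖m' + T m‖)^{-N}`, with `m` the shearlet position and `m'` the curvelet
position (`exists_crossGramian_bound`).

In a row or a column only boundedly many scales and orientations therefore survive, and the position
sums converge uniformly once `N p ≥ 4`. For columns `T⁻¹` has to be bounded too, which follows from
`|det T| = (2^{-j/2} / 2^{-j'/2})³`. -/

/-! ### Inverse Fourier transforms: integrability, orthogonality, uniform decay. -/

theorem invFourier_eq_fourierInv (g : Plane → ℂ) (x : Plane) :
    invFourier g x = ((((2 * Real.pi) ^ 2)⁻¹ : ℝ) : ℂ) * 𝓕⁻ g ((2 * Real.pi)⁻¹ • x) := by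
  rw [invFourier, Real.fourierInv_eq']
  congr 2
  ext ξ
  rw [smul_eq_mul, mul_comm, real_inner_smul_right, real_inner_comm]
  congr 2
  push_cast
  have : (Real.pi : ℂ) ≠ 0 := by exact_mod_cast Real.pi_ne_zero
  field_simp

/-- The inverse Fourier transform of a Schwartz function, as a Schwartz function. -/
noncomputable def invFourierSchwartz (g : 𝓢(Plane, ℂ)) : 𝓢(Plane, ℂ) :=
  ((((2 * Real.pi) ^ 2)⁻¹ : ℝ) : ℂ) • SchwartzMap.compCLMOfContinuousLinearEquiv ℂ
    (ContinuousLinearEquiv.smulLeft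
      (Units.mk0 (2 * Real.pi)⁻¹ (inv_ne_zero Real.two_pi_pos.ne'))) (𝓕⁻ g)

theorem invFourierSchwartz_apply (g : 𝓢(Plane, ℂ)) (x : Plane) :
    invFourierSchwartz g x = invFourier g x := by
  rw [invFourier_eq_fourierInv, ← SchwartzMap.fourierInv_coe]
  rfl

theorem memLp_invFourier {g : Plane → ℂ} (hg : ContDiff ℝ ∞ g) (hc : HasCompactSupport g) :
    MemLp (invFourier g) 2 volume := by
  have h : invFourier g = invFourierSchwartz (hc.toSchwartzMap hg) := by
    ext x
    rw [invFourierSchwartz_apply]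
    rfl
  rw [h]
  exact SchwartzMap.memLp _ 2 volume

/-- Plancherel reduces the pairing to a multiple of the integral of `f` times the conjugate of `g`,
whose integrand vanishes pointwise. Only vanishing matters, so the normalising constants need no
care. -/
theorem l2Inner_invFourier_eq_zero {f g : Plane → ℂ} (hf : ContDiff ℝ ∞ f)
    (hfc : HasCompactSupport f) (hg : ContDiff ℝ ∞ g) (hgc : HasCompactSupport g)
    (h : ∀ ξ, f ξ = 0 ∨ g ξ = 0) : l2Inner (invFourier f) (invFourier g) = 0 := by
  set F := hfc.toSchwartzMap hf with hF
  set G := hgc.toSchwartzMap hg with hG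
  have key : ∫ x, 𝓕⁻ f x * conj (𝓕⁻ g x) = 0 := by
    have h1 := SchwartzMap.integral_inner_fourier_fourier (𝓕⁻ G) (𝓕⁻ F)
    simp only [FourierTransform.fourier_fourierInv_eq] at h1
    have h2 : ∫ x, inner ℂ (G x) (F x) = 0 := by
      rw [← integral_zero Plane ℂ (μ := volume)]
      congr 1
      ext x
      rcases h x with h | h <;> simp [hF, hG, h]
    rw [h2] at h1
    rw [h1]
    congr 1
    ext x
    rw [SchwartzMap.fourierInv_coe F, SchwartzMap.fourierInv_coe G]
    rfl
  have e : ∀ x, invFourier f x * conj (invFourier g x) =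
      (fun y => ((((2 * Real.pi) ^ 2)⁻¹ : ℝ) : ℂ) ^ 2 * (𝓕⁻ f y * conj (𝓕⁻ g y)))
        ((2 * Real.pi)⁻¹ • x) := by
    intro x
    simp only [invFourier_eq_fourierInv, map_mul, Complex.conj_ofReal]
    ring
  rw [l2Inner, integral_congr_ae (Filter.Eventually.of_forall e),
    Measure.integral_comp_smul volume
      (fun y => ((((2 * Real.pi) ^ 2)⁻¹ : ℝ) : ℂ) ^ 2 * (𝓕⁻ f y * conj (𝓕⁻ g y))), integral_const_mul, key]
  simp

/-- The slices of `K` form a bounded family in Schwartz space, and a continuous linear map sends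
bounded families to bounded families. This is what makes the curvelet estimates independent of the
scale. -/
theorem exists_uniform_decay_invFourier {K : ℝ × Plane → ℂ} (hK : ContDiff ℝ ∞ K)
    (hc : HasCompactSupport K) (N : ℕ) :
    ∃ C : ℝ, ∀ (e : ℝ) (x : Plane),
      (1 + ‖x‖) ^ N * ‖invFourier (fun ζ => K (e, ζ)) x‖ ≤ C := by
  have hs : ∀ e : ℝ, ContDiff ℝ ∞ (fun ζ : Plane => K (e, ζ)) := fun e =>
    hK.comp (contDiff_const.prodMk contDiff_id)
  have hsc : ∀ e : ℝ, HasCompactSupport (fun ζ : Plane => K (e, ζ)) := by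
    intro e
    refine hc.comp_isClosedEmbedding (g := fun ζ : Plane => (e, ζ)) ?_
    refine ⟨isEmbedding_prodMkRight e, ?_⟩
    convert! (isClosed_singleton (x := e)).preimage continuous_fst
    ext ⟨a, b⟩
    simp [eq_comm]
  let Ke : ℝ → 𝓢(Plane, ℂ) := fun e => (hsc e).toSchwartzMap (hs e)
  let KS : 𝓢(ℝ × Plane, ℂ) := hc.toSchwartzMap hK
  have hbound : ∀ k n : ℕ, ∃ M : ℝ, 0 ≤ M ∧ ∀ e, SchwartzMap.seminorm ℂ k n (Ke e) ≤ M := by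
    intro k n
    obtain ⟨M, hM0, hM⟩ := KS.decay k n
    refine ⟨M * ‖ContinuousLinearMap.inr ℝ ℝ Plane‖ ^ n, by positivity, fun e => ?_⟩
    refine SchwartzMap.seminorm_le_bound ℂ k n _ (by positivity) fun x => ?_
    -- A slice is a translate of `K` restricted to the subspace `{0} × Plane`, so its derivatives
    -- are controlled by those of `K`.
    have e1 : (Ke e : Plane → ℂ) =
        (fun z => K (z + (e, 0))) ∘ (ContinuousLinearMap.inr ℝ ℝ Plane) := by
      ext z
      simp [Ke]
    have hK' : ContDiff ℝ ∞ (fun z => K (z + (e, 0))) := hK.comp (contDiff_id.add contDiff_const)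
    rw [e1, ContinuousLinearMap.iteratedFDeriv_comp_right (i := n)
      (ContinuousLinearMap.inr ℝ ℝ Plane)
      hK' x (by exact_mod_cast le_top),
      iteratedFDeriv_comp_add_right]
    have h1 := ContinuousMultilinearMap.norm_compContinuousLinearMap_le
      (iteratedFDeriv ℝ n K (ContinuousLinearMap.inr ℝ ℝ Plane x + (e, 0)))
      (fun _ => ContinuousLinearMap.inr ℝ ℝ Plane)
    simp only [Finset.prod_const, Finset.card_univ, Fintype.card_fin] at h1
    have h2 := hM (ContinuousLinearMap.inr ℝ ℝ Plane x + (e, 0))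
    have h3 : ‖x‖ ≤ ‖(ContinuousLinearMap.inr ℝ ℝ Plane x + (e, 0))‖ := by
      simp [Prod.norm_def]
    calc _ ≤ ‖(ContinuousLinearMap.inr ℝ ℝ Plane x + (e, 0))‖ ^ k *
          (‖iteratedFDeriv ℝ n K (ContinuousLinearMap.inr ℝ ℝ Plane x + (e, 0))‖ *
            ‖ContinuousLinearMap.inr ℝ ℝ Plane‖ ^ n) := by gcongr
      _ ≤ _ := by
        rw [← mul_assoc]
        gcongr
        exact h2
  let L : 𝓢(Plane, ℂ) →L[ℂ] 𝓢(Plane, ℂ) :=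
    ((((2 * Real.pi) ^ 2)⁻¹ : ℝ) : ℂ) • ((SchwartzMap.compCLMOfContinuousLinearEquiv ℂ
    (ContinuousLinearEquiv.smulLeft
      (Units.mk0 (2 * Real.pi)⁻¹ (inv_ne_zero Real.two_pi_pos.ne')))).comp
        (FourierTransform.fourierInvCLM ℂ 𝓢(Plane, ℂ)))
  have hL : ∀ g, L g = invFourierSchwartz g := fun g => rfl
  have hsem : ∀ p : ℕ × ℕ, ∃ M : ℝ, ∀ e, SchwartzMap.seminorm ℂ p.1 p.2 (L (Ke e)) ≤ M := by
    intro p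
    let q : Seminorm ℂ 𝓢(Plane, ℂ) := (SchwartzMap.seminorm ℂ p.1 p.2).comp L.toLinearMap
    have hq : Continuous q :=
      ((schwartz_withSeminorms ℂ Plane ℂ).continuous_seminorm p).comp L.continuous
    -- Continuity bounds each output seminorm by finitely many input seminorms, each already uniform
    -- in `e`.
    obtain ⟨s, C, -, hC⟩ := Seminorm.bound_of_continuous (schwartz_withSeminorms ℂ Plane ℂ) q hq
    choose M hM0 hM using fun r : ℕ × ℕ => hbound r.1 r.2
    refine ⟨C * ∑ r ∈ s, M r, fun e => (hC (Ke e)).trans ?_⟩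
    rw [smul_apply]
    refine mul_le_mul_of_nonneg_left ?_ C.2
    refine Seminorm.finset_sup_apply_le (Finset.sum_nonneg fun r _ => hM0 r) fun r hr => ?_
    exact (hM r e).trans (Finset.single_le_sum (f := M) (fun r _ => hM0 r) hr)
  choose M hM using hsem
  refine ⟨2 ^ N * ∑ r ∈ Finset.Iic (N, 0), M r, fun e x => ?_⟩
  have h1 := SchwartzMap.one_add_le_sup_seminorm_apply (𝕜 := ℂ) (m := (N, 0)) (k := N) (n := 0)
    le_rfl le_rfl (L (Ke e)) x
  rw [norm_iteratedFDeriv_zero, hL, invFourierSchwartz_apply] at h1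
  refine h1.trans ?_
  refine mul_le_mul_of_nonneg_left ?_ (by positivity)
  have hM0 : ∀ r, 0 ≤ M r := fun r => (apply_nonneg _ _).trans (hM r 0)
  refine Seminorm.finset_sup_apply_le (Finset.sum_nonneg fun r _ => hM0 r) fun r hr => ?_
  rw [← hL]
  exact (hM r e).trans (Finset.single_le_sum (f := M) (fun r _ => hM0 r) hr)

/-! ### Frequency profiles of shearlets and curvelets. -/

theorem IsRadialWindow.abs_mem {W : ℝ → ℂ} (hW : IsRadialWindow W) {x : ℝ} (hx : W x ≠ 0) :
    1 / 2 ≤ |x| ∧ |x| ≤ 2 := by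
  rcases hW.support_subset (subset_tsupport W hx) with ⟨h1, h2⟩ | ⟨h1, h2⟩
  · rw [abs_of_neg (by linarith)]
    constructor <;> linarith
  · rw [abs_of_pos (by linarith)]
    constructor <;> linarith

theorem IsDirectionalWindow.abs_le {V : ℝ → ℂ} (hV : IsDirectionalWindow V) {x : ℝ}
    (hx : V x ≠ 0) : |x| ≤ 1 :=
  _root_.abs_le.2 (hV.support_subset (subset_tsupport V hx))

/-- The singularity of `arctan t / t` at `0` is removable by analyticity. The quotient lets `e⁻¹
arctan(e s)` be written as `s` times a smooth function of `e s`, which makes sense at `e = 0`. -/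
theorem contDiff_dslope_arctan : ContDiff ℝ ∞ (dslope Real.arctan 0) := by
  rw [contDiff_iff_contDiffAt]
  intro t
  by_cases ht : t = 0
  · subst ht
    have h : AnalyticAt ℝ Real.arctan 0 :=
      (Real.contDiff_arctan (n := ω)).contDiffAt.analyticAt
    obtain ⟨p, hp⟩ := h
    exact (hp.has_fpower_series_dslope_fslope.analyticAt).contDiffAt
  · have h : ContDiffAt ℝ ∞ (fun s : ℝ => s⁻¹ * Real.arctan s) t :=
      (contDiffAt_inv ℝ ht).mul Real.contDiff_arctan.contDiffAt
    refine h.congr_of_eventuallyEq ?_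
    filter_upwards [isOpen_ne.mem_nhds ht] with s hs
    rw [dslope_of_ne _ hs, slope_def_field]
    simp [div_eq_inv_mul]

theorem mul_dslope_arctan (t : ℝ) : t * dslope Real.arctan 0 t = Real.arctan t := by
  by_cases ht : t = 0
  · simp [ht]
  · rw [dslope_of_ne _ ht, slope_def_field]
    field_simp
    simp [mul_comm]

theorem contDiff_plane_apply (i : Fin 2) : ContDiff ℝ ∞ (fun ζ : Plane => ζ i) :=
  (EuclideanSpace.proj (𝕜 := ℝ) i).contDiff

/-- The frequency profile of the generating shearlet. -/
noncomputable def shearletProfile (W V : ℝ → ℂ) (ξ : Plane) : ℂ := W (ξ 0) * V (ξ 1 / ξ 0)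

theorem shearletProfile_ne_zero {W V : ℝ → ℂ} (hW : IsRadialWindow W)
    (hV : IsDirectionalWindow V) {ξ : Plane} (h : shearletProfile W V ξ ≠ 0) :
    1 / 2 ≤ |ξ 0| ∧ |ξ 0| ≤ 2 ∧ |ξ 1| ≤ 2 := by
  obtain ⟨h1, h2⟩ := hW.abs_mem (left_ne_zero_of_mul h)
  have h3 := hV.abs_le (right_ne_zero_of_mul h)
  rw [abs_div, div_le_one (by linarith)] at h3
  exact ⟨h1, h2, h3.trans h2⟩

/-- The line `ξ 0 = 0`, where the quotient is singular, is harmless because `W` vanishes near `0`.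
-/
theorem contDiff_shearletProfile {W V : ℝ → ℂ} (hW : IsRadialWindow W)
    (hV : IsDirectionalWindow V) : ContDiff ℝ ∞ (shearletProfile W V) := by
  rw [contDiff_iff_contDiffAt]
  intro ξ
  by_cases h : ξ 0 = 0
  · refine (contDiffAt_const (c := (0 : ℂ))).congr_of_eventuallyEq ?_
    have : {η : Plane | |η 0| < 1 / 2} ∈ nhds ξ := by
      refine (isOpen_lt (by fun_prop) continuous_const).mem_nhds ?_
      simp [h]
    filter_upwards [this] with η hη
    by_contra h'
    have := (shearletProfile_ne_zero hW hV h').1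
    have hη' : |η 0| < 1 / 2 := hη
    linarith
  · refine (hW.smooth.contDiffAt.comp ξ (contDiff_plane_apply 0).contDiffAt).mul ?_
    exact hV.smooth.contDiffAt.comp ξ
      ((contDiff_plane_apply 1).contDiffAt.div (contDiff_plane_apply 0).contDiffAt h)

theorem isCompact_setOf_plane_abs_le (r : ℝ) : IsCompact {ξ : Plane | |ξ 0| ≤ r ∧ |ξ 1| ≤ r} := by
  have hc : IsClosed {ξ : Plane | |ξ 0| ≤ r ∧ |ξ 1| ≤ r} := by
    have h (i : Fin 2) : IsClosed {ξ : Plane | |ξ i| ≤ r} :=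
      isClosed_le (by fun_prop) continuous_const
    exact (h 0).inter (h 1)
  refine Metric.isCompact_of_isClosed_isBounded hc ?_
  rw [isBounded_iff_forall_norm_le]
  refine ⟨Real.sqrt (2 * r ^ 2), fun ξ hξ => ?_⟩
  rw [EuclideanSpace.norm_eq]
  apply Real.sqrt_le_sqrt
  simp only [Fin.sum_univ_two, Real.norm_eq_abs]
  have h1 : |ξ 0| ^ 2 ≤ r ^ 2 := by gcongr; exact hξ.1
  have h2 : |ξ 1| ^ 2 ≤ r ^ 2 := by gcongr; exact hξ.2
  linarith

theorem hasCompactSupport_shearletProfile {W V : ℝ → ℂ} (hW : IsRadialWindow W)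
    (hV : IsDirectionalWindow V) : HasCompactSupport (shearletProfile W V) := by
  refine HasCompactSupport.intro (isCompact_setOf_plane_abs_le 2) fun ξ hξ => ?_
  by_contra h
  exact hξ (shearletProfile_ne_zero hW hV h).2

/-- A cutoff equal to `1` on the scales `[0, 1]`. -/
noncomputable def scaleCutoff : ContDiffBump (1 / 2 : ℝ) := ⟨1 / 2, 1, by norm_num, by norm_num⟩

/-- A cutoff equal to `1` on `[1/5, 23/10]` and supported in `[1/10, 12/5]`. -/
noncomputable def radialCutoff : ContDiffBump (5 / 4 : ℝ) :=
  ⟨21 / 20, 23 / 20, by norm_num, by norm_num⟩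

/-- A cutoff equal to `1` on `[-4, 4]` and supported in `[-5, 5]`. -/
noncomputable def transversalCutoff : ContDiffBump (0 : ℝ) := ⟨4, 5, by norm_num, by norm_num⟩

/-- The frequency profile of a curvelet in parabolic coordinates, jointly in `ε = 2^{-j/2}` and the
frequency. It is smooth up to and beyond `ε = 0`. -/
noncomputable def curveletProfile (W V : ℝ → ℂ) (z : ℝ × Plane) : ℂ :=
  ((scaleCutoff z.1 * radialCutoff (z.2 0) * transversalCutoff (z.2 1) : ℝ) : ℂ) *
    (W (Real.sqrt (z.2 0 ^ 2 + z.1 ^ 2 * z.2 1 ^ 2)) *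
      V (z.2 1 / z.2 0 * dslope Real.arctan 0 (z.1 * (z.2 1 / z.2 0))))

theorem curveletProfile_ne_zero {W V : ℝ → ℂ} {z : ℝ × Plane} (h : curveletProfile W V z ≠ 0) :
    |z.1| ≤ 2 ∧ 1 / 10 ≤ z.2 0 ∧ z.2 0 ≤ 12 / 5 ∧ |z.2 1| ≤ 5 := by
  have h1 := left_ne_zero_of_mul h
  rw [Complex.ofReal_ne_zero] at h1
  have h2 : transversalCutoff (z.2 1) ≠ 0 := right_ne_zero_of_mul h1
  have h3 : radialCutoff (z.2 0) ≠ 0 := right_ne_zero_of_mul (left_ne_zero_of_mul h1)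
  have h4 : scaleCutoff z.1 ≠ 0 := left_ne_zero_of_mul (left_ne_zero_of_mul h1)
  have a2 : |z.2 1 - 0| < 5 := by
    by_contra hn
    exact h2 (transversalCutoff.zero_of_le_dist (by rw [Real.dist_eq]; exact not_lt.1 hn))
  have a3 : |z.2 0 - 5 / 4| < 23 / 20 := by
    by_contra hn
    exact h3 (radialCutoff.zero_of_le_dist (by rw [Real.dist_eq]; exact not_lt.1 hn))
  have a4 : |z.1 - 1 / 2| < 1 := by
    by_contra hn
    exact h4 (scaleCutoff.zero_of_le_dist (by rw [Real.dist_eq]; exact not_lt.1 hn))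
  rw [abs_lt] at a2 a3 a4
  refine ⟨abs_le.2 ⟨?_, ?_⟩, ?_, ?_, abs_le.2 ⟨?_, ?_⟩⟩ <;> linarith

theorem hasCompactSupport_curveletProfile (W V : ℝ → ℂ) :
    HasCompactSupport (curveletProfile W V) := by
  refine HasCompactSupport.intro ((isCompact_Icc (a := (-2 : ℝ)) (b := 2)).prod
    (isCompact_setOf_plane_abs_le 5)) fun z hz => ?_
  by_contra h
  obtain ⟨h1, h2, h3, h4⟩ := curveletProfile_ne_zero h
  exact hz ⟨abs_le.1 h1, abs_le.2 ⟨by linarith, by linarith⟩, h4⟩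

theorem contDiff_curveletProfile {W V : ℝ → ℂ} (hW : IsRadialWindow W)
    (hV : IsDirectionalWindow V) : ContDiff ℝ ∞ (curveletProfile W V) := by
  rw [contDiff_iff_contDiffAt]
  intro z
  have c0 : ContDiff ℝ ∞ (fun z : ℝ × Plane => z.2 0) := (contDiff_plane_apply 0).comp contDiff_snd
  have c1 : ContDiff ℝ ∞ (fun z : ℝ × Plane => z.2 1) := (contDiff_plane_apply 1).comp contDiff_snd
  by_cases h : z.2 0 < 1 / 10
  · refine (contDiffAt_const (c := (0 : ℂ))).congr_of_eventuallyEq ?_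
    filter_upwards [(isOpen_lt c0.continuous continuous_const).mem_nhds h] with w hw
    by_contra h'
    have := (curveletProfile_ne_zero h').2.1
    have hw' : w.2 0 < 1 / 10 := hw
    linarith
  · have hpos : 0 < z.2 0 := by linarith [not_lt.1 h]
    have cq : ContDiffAt ℝ ∞ (fun z : ℝ × Plane => z.2 1 / z.2 0) z :=
      c1.contDiffAt.div c0.contDiffAt hpos.ne'
    refine ContDiffAt.mul ?_ (ContDiffAt.mul ?_ ?_)
    · refine Complex.ofRealCLM.contDiff.contDiffAt.comp z ?_
      exact ((scaleCutoff.contDiff.comp contDiff_fst).mul (radialCutoff.contDiff.comp c0)).mul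
        (transversalCutoff.contDiff.comp c1) |>.contDiffAt
    · refine hW.smooth.contDiffAt.comp z (ContDiffAt.sqrt ?_ ?_)
      · exact ((c0.pow 2).add ((contDiff_fst.pow 2).mul (c1.pow 2))).contDiffAt
      · positivity
    · refine hV.smooth.contDiffAt.comp z (cq.mul ?_)
      exact contDiff_dslope_arctan.contDiffAt.comp z (contDiff_fst.contDiffAt.mul cq)

theorem contDiff_curveletProfile_slice {W V : ℝ → ℂ} (hW : IsRadialWindow W)
    (hV : IsDirectionalWindow V) (e : ℝ) :
    ContDiff ℝ ∞ (fun ζ : Plane => curveletProfile W V (e, ζ)) :=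
  (contDiff_curveletProfile hW hV).comp (contDiff_const.prodMk contDiff_id)

theorem hasCompactSupport_curveletProfile_slice (W V : ℝ → ℂ) (e : ℝ) :
    HasCompactSupport (fun ζ : Plane => curveletProfile W V (e, ζ)) := by
  refine HasCompactSupport.intro (isCompact_setOf_plane_abs_le 5) fun ζ hζ => ?_
  by_contra h
  obtain ⟨-, h2, h3, h4⟩ := curveletProfile_ne_zero h
  dsimp only at h2 h3
  exact hζ ⟨abs_le.2 ⟨by linarith, by linarith⟩, h4⟩

/-- With `y = arctan t` and `|y| ≤ 1`, one has `cos y ≥ 1 - y²/2 ≥ 1/2`, hence `|tan y| ≤ 2 |sin y|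
≤ 2 |y|`. -/
theorem abs_le_two_mul_abs_arctan {t : ℝ} (h : |Real.arctan t| ≤ 1) :
    |t| ≤ 2 * |Real.arctan t| := by
  set y := Real.arctan t
  have ht : t = Real.tan y := (Real.tan_arctan t).symm
  have hc : 1 / 2 ≤ Real.cos y := by
    have := Real.one_sub_sq_div_two_le_cos (x := y)
    have h2 : y ^ 2 ≤ 1 := by rw [← sq_abs]; nlinarith [abs_nonneg y]
    linarith
  rw [ht, Real.tan_eq_sin_div_cos, abs_div, abs_of_pos (by linarith : 0 < Real.cos y),
    div_le_iff₀ (by linarith)]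
  nlinarith [Real.abs_sin_le_abs (x := y), abs_nonneg y]

/-- The cutoffs cost nothing. For `ζ 0 > 0` the argument is an arctangent, and wherever the left
side is nonzero all three cutoffs equal `1`. For `ζ 0 ≤ 0` both sides vanish, since the angular
window only admits `|arg| ≤ e ≤ 1 < π/2`. -/
theorem curveletProfile_eq {W V : ℝ → ℂ} (hW : IsRadialWindow W) (hV : IsDirectionalWindow V)
    {e : ℝ} (he : 0 < e) (he1 : e ≤ 1) (ζ : Plane) :
    W (Real.sqrt (ζ 0 ^ 2 + e ^ 2 * ζ 1 ^ 2)) * V (e⁻¹ * Complex.arg ⟨ζ 0, e * ζ 1⟩) =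
      curveletProfile W V (e, ζ) := by
  rcases lt_or_ge 0 (ζ 0) with h | h
  · have harg : Complex.arg ⟨ζ 0, e * ζ 1⟩ = Real.arctan (e * (ζ 1 / ζ 0)) := by
      have h1 := Complex.tan_arg ⟨ζ 0, e * ζ 1⟩
      have h2 : |Complex.arg ⟨ζ 0, e * ζ 1⟩| < Real.pi / 2 :=
        Complex.abs_arg_lt_pi_div_two_iff.2 (Or.inl h)
      rw [abs_lt] at h2
      rw [← Real.arctan_tan h2.1 h2.2, h1]
      congr 1
      simp [mul_div_assoc]
    have hV' : e⁻¹ * Complex.arg ⟨ζ 0, e * ζ 1⟩ =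
        ζ 1 / ζ 0 * dslope Real.arctan 0 (e * (ζ 1 / ζ 0)) := by
      rw [harg, ← mul_dslope_arctan (e * (ζ 1 / ζ 0))]
      field_simp
    by_cases hz : W (Real.sqrt (ζ 0 ^ 2 + e ^ 2 * ζ 1 ^ 2)) *
        V (e⁻¹ * Complex.arg ⟨ζ 0, e * ζ 1⟩) = 0
    · rw [curveletProfile, ← hV', hz, mul_zero]
    · obtain ⟨r1, r2⟩ := hW.abs_mem (left_ne_zero_of_mul hz)
      have v := hV.abs_le (right_ne_zero_of_mul hz)
      rw [abs_of_nonneg (Real.sqrt_nonneg _)] at r1 r2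
      rw [harg, abs_mul, abs_of_pos (inv_pos.2 he), inv_mul_le_iff₀ he, mul_one] at v
      have ht := abs_le_two_mul_abs_arctan (v.trans he1)
      rw [abs_mul, abs_of_pos he, abs_div, abs_of_pos h] at ht
      have h10 : |ζ 1| ≤ 2 * ζ 0 := by
        have : |ζ 1| / ζ 0 ≤ 2 := by
          by_contra hn
          nlinarith [not_le.1 hn]
        rwa [div_le_iff₀ h] at this
      have hsq : ζ 1 ^ 2 ≤ 4 * ζ 0 ^ 2 := by
        rw [← sq_abs (ζ 1)]
        nlinarith [abs_nonneg (ζ 1)]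
      have he2 : e ^ 2 ≤ 1 := by nlinarith
      have hb : e ^ 2 * ζ 1 ^ 2 ≤ 4 * ζ 0 ^ 2 := by nlinarith [sq_nonneg (ζ 1)]
      have u : ζ 0 ≤ 2 := by
        refine le_trans ?_ r2
        apply Real.le_sqrt_of_sq_le
        nlinarith [mul_nonneg (sq_nonneg e) (sq_nonneg (ζ 1))]
      -- Here `1/4 ≤ ζ 0² + e² ζ 1² ≤ 5 ζ 0²`. Together with `ζ 0 ≤ 2` and `|ζ 1| ≤ 2 ζ 0 ≤ 4` this
      -- explains the plateaus of the cutoffs.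
      have l : 1 / 5 ≤ ζ 0 := by
        rw [Real.le_sqrt' (by norm_num)] at r1
        nlinarith
      have b0 : scaleCutoff e = 1 := by
        apply scaleCutoff.one_of_mem_closedBall
        rw [Metric.mem_closedBall, Real.dist_eq, abs_le]
        change -(1 / 2) ≤ _ ∧ _ ≤ 1 / 2
        constructor <;> linarith
      have b1 : radialCutoff (ζ 0) = 1 := by
        apply radialCutoff.one_of_mem_closedBall
        rw [Metric.mem_closedBall, Real.dist_eq, abs_le]
        change -(21 / 20) ≤ _ ∧ _ ≤ 21 / 20
        constructor <;> linarith
      have b2 : transversalCutoff (ζ 1) = 1 := by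
        apply transversalCutoff.one_of_mem_closedBall
        rw [Metric.mem_closedBall, Real.dist_eq, sub_zero]
        change _ ≤ 4
        linarith
      rw [curveletProfile, ← hV']
      simp [b0, b1, b2]
  · trans (0 : ℂ)
    · by_contra hz
      obtain ⟨r1, r2⟩ := hW.abs_mem (left_ne_zero_of_mul hz)
      have v := hV.abs_le (right_ne_zero_of_mul hz)
      rw [abs_mul, abs_of_pos (inv_pos.2 he), inv_mul_le_iff₀ he, mul_one] at v
      have h2 : |Complex.arg ⟨ζ 0, e * ζ 1⟩| < Real.pi / 2 := by
        linarith [Real.pi_gt_three]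
      rcases Complex.abs_arg_lt_pi_div_two_iff.1 h2 with h3 | h3
      · exact absurd h3 (not_lt.2 h)
      · have e0 : ζ 0 = 0 := congrArg Complex.re h3
        have e1 : e * ζ 1 = 0 := congrArg Complex.im h3
        rw [e0, ← mul_pow, e1] at r1
        norm_num at r1
    · by_contra hz
      have := (curveletProfile_ne_zero (Ne.symm hz)).2.1
      simp only at this
      linarith

/-! ### Affine changes of variables in space and frequency. -/

theorem matAct_mul (M N : Matrix (Fin 2) (Fin 2) ℝ) (x : Plane) :
    matAct (M * N) x = matAct M (matAct N x) := by
  simp only [matAct, Matrix.mulVec_mulVec]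

theorem matAct_add (M : Matrix (Fin 2) (Fin 2) ℝ) (x y : Plane) :
    matAct M (x + y) = matAct M x + matAct M y :=
  map_add (Matrix.toLpLin 2 2 M) x y

theorem matAct_one (x : Plane) : matAct 1 x = x := by simp [matAct]

theorem matAct_apply (M : Matrix (Fin 2) (Fin 2) ℝ) (x : Plane) (i : Fin 2) :
    matAct M x i = M i 0 * x 0 + M i 1 * x 1 := by
  simp only [matAct, Matrix.mulVec, dotProduct, Fin.sum_univ_two]

theorem inner_plane (x y : Plane) : inner ℝ x y = x 0 * y 0 + x 1 * y 1 := by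
  simp [PiLp.inner_apply, Fin.sum_univ_two, mul_comm]

theorem inner_matAct (M : Matrix (Fin 2) (Fin 2) ℝ) (x y : Plane) :
    inner ℝ (matAct M x) y = inner ℝ x (matAct M.transpose y) := by
  simp only [inner_plane, matAct_apply, Matrix.transpose_apply]
  ring

/-- The action of an invertible matrix as a continuous linear automorphism of the plane. -/
noncomputable def matEquiv (M : Matrix (Fin 2) (Fin 2) ℝ) (h : M.det ≠ 0) : Plane ≃L[ℝ] Plane :=
  (LinearMap.equivOfDetNeZero (Matrix.toLpLin 2 2 M)
    (by rwa [Matrix.toLpLin_eq_toLin, LinearMap.det_toLin])).toContinuousLinearEquiv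

theorem map_matAct_volume {M : Matrix (Fin 2) (Fin 2) ℝ} (h : M.det ≠ 0) :
    Measure.map (matEquiv M h) (volume : Measure Plane) = ENNReal.ofReal |M.det⁻¹| • volume := by
  have hdet : LinearMap.det (Matrix.toLpLin 2 2 M) = M.det := by
    rw [Matrix.toLpLin_eq_toLin, LinearMap.det_toLin]
  have := Measure.map_linearMap_addHaar_eq_smul_addHaar (volume : Measure Plane)
    (f := Matrix.toLpLin 2 2 M) (by rwa [hdet])
  rw [hdet] at this
  exact this

theorem integral_comp_matAct {E : Type*} [NormedAddCommGroup E] [NormedSpace ℝ E]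
    {M : Matrix (Fin 2) (Fin 2) ℝ} (h : M.det ≠ 0) (g : Plane → E) :
    ∫ x, g (matAct M x) = |M.det|⁻¹ • ∫ x, g x := by
  have h1 := (matEquiv M h).toHomeomorph.measurableEmbedding.integral_map (μ := volume) g
  change ∫ y, g y ∂(Measure.map (matEquiv M h) volume) = ∫ x, g (matAct M x) at h1
  rw [map_matAct_volume h, integral_smul_measure, ENNReal.toReal_ofReal (abs_nonneg _),
    abs_inv] at h1
  exact h1.symm

theorem invFourier_comp_matAct {B N : Matrix (Fin 2) (Fin 2) ℝ} (hBN : B.transpose * N = 1)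
    (F : Plane → ℂ) (t x : Plane) :
    invFourier (fun ξ => F (matAct N ξ) *
      Complex.exp (Complex.I * ((inner ℝ t (matAct N ξ) : ℝ) : ℂ))) x =
      ((|B.det| : ℝ) : ℂ) * invFourier F (matAct B x + t) := by
  have hdet : B.det * N.det = 1 := by
    rw [← Matrix.det_transpose B, ← Matrix.det_mul, hBN, Matrix.det_one]
  have hN : N.det ≠ 0 := right_ne_zero_of_mul_eq_one hdet
  let g : Plane → ℂ := fun ζ =>
    F ζ * Complex.exp (Complex.I * ((inner ℝ (matAct B x + t) ζ : ℝ) : ℂ))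
  have h : ∀ ξ, F (matAct N ξ) *
      Complex.exp (Complex.I * ((inner ℝ t (matAct N ξ) : ℝ) : ℂ)) *
      Complex.exp (Complex.I * ((inner ℝ x ξ : ℝ) : ℂ)) = g (matAct N ξ) := by
    intro ξ
    have e : inner ℝ (matAct B x) (matAct N ξ) = inner ℝ x ξ := by
      rw [inner_matAct, ← matAct_mul, hBN, matAct_one]
    simp only [g]
    rw [inner_add_left, e, mul_assoc, ← Complex.exp_add]
    congr 2
    push_cast
    ring
  simp only [invFourier]
  rw [integral_congr_ae (Filter.Eventually.of_forall h), integral_comp_matAct hN]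
  have : |N.det|⁻¹ = |B.det| := by
    rw [← abs_inv, ← eq_inv_of_mul_eq_one_left hdet]
  rw [this, Complex.real_smul]
  ring

/-- The Fourier transform of `x ↦ |det B| · invFourier F (B x + t)`, where `N = B^{-T}`. -/
noncomputable def affineHat (N : Matrix (Fin 2) (Fin 2) ℝ) (t : Plane) (F : Plane → ℂ)
    (ξ : Plane) : ℂ :=
  F (matAct N ξ) * Complex.exp (Complex.I * ((inner ℝ t (matAct N ξ) : ℝ) : ℂ))

theorem contDiff_affineHat {N : Matrix (Fin 2) (Fin 2) ℝ} (hN : N.det ≠ 0) (t : Plane)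
    {F : Plane → ℂ} (hF : ContDiff ℝ ∞ F) : ContDiff ℝ ∞ (affineHat N t F) := by
  have h : ContDiff ℝ ∞ (matAct N) := (matEquiv N hN).contDiff
  refine (hF.comp h).mul (Complex.contDiff_exp.comp (contDiff_const.mul
    (Complex.ofRealCLM.contDiff.comp ?_)))
  exact contDiff_const.inner ℝ h

theorem hasCompactSupport_affineHat {N : Matrix (Fin 2) (Fin 2) ℝ} (hN : N.det ≠ 0) (t : Plane)
    {F : Plane → ℂ} (hF : HasCompactSupport F) : HasCompactSupport (affineHat N t F) :=
  (hF.comp_homeomorph (matEquiv N hN).toHomeomorph).mul_right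

theorem memLp_affine {B N : Matrix (Fin 2) (Fin 2) ℝ} (hBN : B.transpose * N = 1) (t : Plane)
    {F : Plane → ℂ} (hF : ContDiff ℝ ∞ F) (hc : HasCompactSupport F) (c : ℂ) :
    MemLp (fun x => c * invFourier F (matAct B x + t)) 2 volume := by
  have hdet : B.det * N.det = 1 := by
    rw [← Matrix.det_transpose B, ← Matrix.det_mul, hBN, Matrix.det_one]
  have hN : N.det ≠ 0 := right_ne_zero_of_mul_eq_one hdet
  have hB : ((|B.det| : ℝ) : ℂ) ≠ 0 := by
    exact_mod_cast abs_ne_zero.2 (left_ne_zero_of_mul_eq_one hdet)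
  convert! (memLp_invFourier (contDiff_affineHat hN t hF)
    (hasCompactSupport_affineHat hN t hc)).const_mul (c * ((|B.det| : ℝ) : ℂ)⁻¹) using 1
  ext x
  have := invFourier_comp_matAct hBN F t x
  unfold affineHat
  rw [this]
  field_simp

theorem l2Inner_const_mul (c d : ℂ) (f g : Plane → ℂ) :
    l2Inner (fun x => c * f x) (fun x => d * g x) = c * conj d * l2Inner f g := by
  simp only [l2Inner, map_mul]
  rw [← integral_const_mul]
  congr 1
  ext x
  ring

/-- Since `N = Tᵀ N'`, both frequency supports can be compared in the single coordinate `ζ = N' ξ`.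
-/
theorem l2Inner_affine_eq_zero {B B' N N' T : Matrix (Fin 2) (Fin 2) ℝ}
    (hBN : B.transpose * N = 1) (hBN' : B'.transpose * N' = 1) (hT : T * B = B') (t t' : Plane)
    {F G : Plane → ℂ} (hF : ContDiff ℝ ∞ F) (hFc : HasCompactSupport F) (hG : ContDiff ℝ ∞ G)
    (hGc : HasCompactSupport G) (h : ∀ ζ, F (matAct T.transpose ζ) = 0 ∨ G ζ = 0) (c c' : ℂ) :
    l2Inner (fun x => c * invFourier F (matAct B x + t))
      (fun x => c' * invFourier G (matAct B' x + t')) = 0 := by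
  have hdet : B.det * N.det = 1 := by
    rw [← Matrix.det_transpose B, ← Matrix.det_mul, hBN, Matrix.det_one]
  have hdet' : B'.det * N'.det = 1 := by
    rw [← Matrix.det_transpose B', ← Matrix.det_mul, hBN', Matrix.det_one]
  have hN : N.det ≠ 0 := right_ne_zero_of_mul_eq_one hdet
  have hN' : N'.det ≠ 0 := right_ne_zero_of_mul_eq_one hdet'
  have hB : ((|B.det| : ℝ) : ℂ) ≠ 0 := by
    exact_mod_cast abs_ne_zero.2 (left_ne_zero_of_mul_eq_one hdet)
  have hB' : ((|B'.det| : ℝ) : ℂ) ≠ 0 := by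
    exact_mod_cast abs_ne_zero.2 (left_ne_zero_of_mul_eq_one hdet')
  have hNB : N * B.transpose = 1 := mul_eq_one_comm.1 hBN
  have hNT : N = T.transpose * N' := by
    have : T.transpose = N * B'.transpose := by
      rw [← hT, Matrix.transpose_mul, ← mul_assoc, hNB, one_mul]
    rw [this, mul_assoc, hBN', mul_one]
  have key := l2Inner_invFourier_eq_zero (contDiff_affineHat hN t hF)
    (hasCompactSupport_affineHat hN t hFc) (contDiff_affineHat hN' t' hG)
    (hasCompactSupport_affineHat hN' t' hGc) (fun ξ => by
      rcases h (matAct N' ξ) with h | h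
      · left
        rw [affineHat, hNT, matAct_mul, h, zero_mul]
      · right
        rw [affineHat, h, zero_mul])
  have e1 : invFourier (affineHat N t F) =
      fun x => ((|B.det| : ℝ) : ℂ) * invFourier F (matAct B x + t) :=
    funext (invFourier_comp_matAct hBN F t)
  have e2 : invFourier (affineHat N' t' G) =
      fun x => ((|B'.det| : ℝ) : ℂ) * invFourier G (matAct B' x + t') :=
    funext (invFourier_comp_matAct hBN' G t')
  rw [e1, e2, l2Inner_const_mul] at key
  rw [l2Inner_const_mul]
  have hz := (mul_eq_zero.1 key).resolve_left (mul_ne_zero hB (by simpa using hB'))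
  rw [hz, mul_zero]

theorem norm_matAct_le {T : Matrix (Fin 2) (Fin 2) ℝ} {r : ℝ} (hT : ∀ i j, |T i j| ≤ r)
    (x : Plane) : ‖matAct T x‖ ≤ 4 * r * ‖x‖ := by
  have hr : 0 ≤ r := (abs_nonneg _).trans (hT 0 0)
  have hx : ∀ i, |x i| ≤ ‖x‖ := fun i => PiLp.norm_apply_le x i
  have hi : ∀ i, |matAct T x i| ≤ 2 * r * ‖x‖ := by
    intro i
    rw [matAct_apply]
    calc |T i 0 * x 0 + T i 1 * x 1| ≤ |T i 0| * |x 0| + |T i 1| * |x 1| := by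
          rw [← abs_mul, ← abs_mul]
          exact abs_add_le _ _
      _ ≤ r * ‖x‖ + r * ‖x‖ := by
          gcongr
          exacts [hT i 0, hx 0, hT i 1, hx 1]
      _ = _ := by ring
  rw [EuclideanSpace.norm_eq, Fin.sum_univ_two]
  apply Real.sqrt_le_iff.2 ⟨by positivity, ?_⟩
  simp only [Real.norm_eq_abs]
  have h0 : |matAct T x 0| ^ 2 ≤ (2 * r * ‖x‖) ^ 2 := by gcongr; exact hi 0
  have h1 : |matAct T x 1| ^ 2 ≤ (2 * r * ‖x‖) ^ 2 := by gcongr; exact hi 1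
  nlinarith [sq_nonneg (r * ‖x‖)]

/-- Substituting `y = Bx + t` leaves the product of `f(y)` with the conjugate of `g(Ty + u)`, `u =
t' - T t`. Of the decay of `f`, `N` powers are traded for decay in `u` and three remain to make the
integral over the plane converge. -/
theorem norm_l2Inner_affine_le {B B' T : Matrix (Fin 2) (Fin 2) ℝ} (hB : B.det ≠ 0)
    (hT : T * B = B') {r : ℝ} (hTr : ∀ i j, |T i j| ≤ r) (t t' : Plane) {f g : Plane → ℂ} {N : ℕ}
    {C D : ℝ} (hf : ∀ x, (1 + ‖x‖) ^ (N + 3) * ‖f x‖ ≤ C) (hg : ∀ x, (1 + ‖x‖) ^ N * ‖g x‖ ≤ D)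
    (c c' : ℂ) :
    ‖l2Inner (fun x => c * f (matAct B x + t)) (fun x => c' * g (matAct B' x + t'))‖ ≤
      ‖c‖ * ‖c'‖ * |B.det|⁻¹ * (C * D * (1 + 4 * r) ^ N * ∫ x : Plane, (1 + ‖x‖) ^ (-3 : ℝ)) *
        ((1 + ‖t' - matAct T t‖) ^ N)⁻¹ := by
  have hr : 0 ≤ r := (abs_nonneg _).trans (hTr 0 0)
  have hC : 0 ≤ C := le_trans (by positivity) (hf 0)
  have hD : 0 ≤ D := le_trans (by positivity) (hg 0)
  let h : Plane → ℂ := fun y => f y * conj (g (matAct T y + (t' - matAct T t)))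
  have e : l2Inner (fun x => f (matAct B x + t)) (fun x => g (matAct B' x + t')) =
      |B.det|⁻¹ • ∫ y, h y := by
    rw [l2Inner, ← integral_add_right_eq_self h t, ← integral_comp_matAct hB]
    congr 1
    ext x
    simp only [h]
    congr 3
    rw [matAct_add, ← matAct_mul, hT]
    abel
  set u := t' - matAct T t
  have hb : ∀ y, ‖h y‖ ≤ C * D * (1 + 4 * r) ^ N * ((1 + ‖u‖) ^ N)⁻¹ * (1 + ‖y‖) ^ (-3 : ℝ) := by
    intro y
    -- Peetre's inequality: `u` is large only if `y` or `Ty + u` is.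
    have p : 1 + ‖u‖ ≤ (1 + 4 * r) * (1 + ‖y‖) * (1 + ‖matAct T y + u‖) := by
      have h1 : ‖u‖ ≤ ‖matAct T y + u‖ + ‖matAct T y‖ := by
        simpa using norm_sub_le (matAct T y + u) (matAct T y)
      have h2 := norm_matAct_le hTr y
      have h3 : 0 ≤ ‖y‖ := norm_nonneg y
      have h4 : 0 ≤ ‖matAct T y + u‖ := norm_nonneg _
      nlinarith [mul_nonneg hr h3, mul_nonneg h3 h4, mul_nonneg hr h4,
        mul_nonneg (mul_nonneg hr h3) h4]
    have p' : (1 + ‖u‖) ^ N ≤ (1 + 4 * r) ^ N * (1 + ‖y‖) ^ N * (1 + ‖matAct T y + u‖) ^ N := by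
      rw [← mul_pow, ← mul_pow]
      gcongr
    have e3 : (1 + ‖y‖) ^ (-3 : ℝ) = ((1 + ‖y‖) ^ 3)⁻¹ := by
      rw [Real.rpow_neg (by positivity)]
      norm_cast
    rw [e3, ← div_eq_mul_inv, ← div_eq_mul_inv, le_div_iff₀ (by positivity),
      le_div_iff₀ (by positivity)]
    simp only [h, norm_mul, RCLike.norm_conj]
    calc ‖f y‖ * ‖g (matAct T y + u)‖ * (1 + ‖y‖) ^ 3 * (1 + ‖u‖) ^ N
        ≤ ‖f y‖ * ‖g (matAct T y + u)‖ * (1 + ‖y‖) ^ 3 *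
          ((1 + 4 * r) ^ N * (1 + ‖y‖) ^ N * (1 + ‖matAct T y + u‖) ^ N) := by gcongr
      _ = ((1 + ‖y‖) ^ (N + 3) * ‖f y‖) *
          ((1 + ‖matAct T y + u‖) ^ N * ‖g (matAct T y + u)‖) * (1 + 4 * r) ^ N := by ring
      _ ≤ C * D * (1 + 4 * r) ^ N := by
          gcongr
          exacts [hf y, hg _]
  have hint : Integrable (fun y : Plane => (1 + ‖y‖) ^ (-3 : ℝ)) :=
    integrable_one_add_norm (by simp; norm_num)
  have hi := norm_integral_le_of_norm_le (hint.const_mul _) (Filter.Eventually.of_forall hb)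
  rw [integral_const_mul] at hi
  rw [l2Inner_const_mul, e, norm_mul, norm_mul, RCLike.norm_conj, norm_smul, Real.norm_eq_abs,
    abs_inv, abs_abs]
  calc _ ≤ ‖c‖ * ‖c'‖ * (|B.det|⁻¹ * (C * D * (1 + 4 * r) ^ N * ((1 + ‖u‖) ^ N)⁻¹ *
          ∫ a : Plane, (1 + ‖a‖) ^ (-3 : ℝ))) := by gcongr
    _ = _ := by ring

/-! ### Shearlets and curvelets in affine form. -/

/-- The aspect ratio `2^{-j/2}` of the frequency tiles at scale `j`. -/
noncomputable def aspect (j : ℕ) : ℝ := ((2 : ℝ) ^ ((j : ℝ) / 2))⁻¹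

theorem aspect_pos (j : ℕ) : 0 < aspect j := by unfold aspect; positivity

theorem aspect_le_one (j : ℕ) : aspect j ≤ 1 :=
  inv_le_one_of_one_le₀ (Real.one_le_rpow (by norm_num) (by positivity))

theorem rpow_half_eq (j : ℕ) : (2 : ℝ) ^ ((j : ℝ) / 2) = (aspect j)⁻¹ := by simp [aspect]

theorem two_pow_eq (j : ℕ) : (2 : ℝ) ^ j = (aspect j ^ 2)⁻¹ := by
  rw [← inv_pow, ← rpow_half_eq, ← Real.rpow_natCast, ← Real.rpow_natCast, ← Real.rpow_mul (by norm_num)]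
  congr 1
  push_cast
  ring

theorem aspect_sq (j : ℕ) : aspect j ^ 2 = ((2 : ℝ) ^ j)⁻¹ := by rw [two_pow_eq, inv_inv]

theorem rpow_three_fourths_sq (j : ℕ) : ((2 : ℝ) ^ (3 * (j : ℝ) / 4)) ^ 2 = (aspect j ^ 3)⁻¹ := by
  rw [← inv_pow, ← rpow_half_eq, ← Real.rpow_natCast, ← Real.rpow_natCast,
    ← Real.rpow_mul (by norm_num), ← Real.rpow_mul (by norm_num)]
  congr 1
  push_cast
  ring

/-- The matrix of the affine map of a shearlet, including the coordinate exchange of the vertical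
cone, with `e = 2^{-j/2}`. -/
noncomputable def shearletMatrix (e : ℝ) (k : ℤ) (cone : Fin 2) : Matrix (Fin 2) (Fin 2) ℝ :=
  if cone = 0 then !![(e ^ 2)⁻¹, k * e⁻¹; 0, e⁻¹] else !![k * e⁻¹, (e ^ 2)⁻¹; e⁻¹, 0]

/-- The inverse transpose of `shearletMatrix`. -/
noncomputable def shearletDual (e : ℝ) (k : ℤ) (cone : Fin 2) : Matrix (Fin 2) (Fin 2) ℝ :=
  if cone = 0 then !![e ^ 2, 0; -(k * e ^ 2), e] else !![0, e ^ 2; e, -(k * e ^ 2)]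

/-- The matrix of the affine map of a curvelet with orientation `θ`, with `e = 2^{-j/2}`. -/
noncomputable def curveletMatrix (e θ : ℝ) : Matrix (Fin 2) (Fin 2) ℝ :=
  !![(e ^ 2)⁻¹ * Real.cos θ, (e ^ 2)⁻¹ * Real.sin θ; -(e⁻¹ * Real.sin θ), e⁻¹ * Real.cos θ]

/-- The inverse transpose of `curveletMatrix`. -/
noncomputable def curveletDual (e θ : ℝ) : Matrix (Fin 2) (Fin 2) ℝ :=
  !![e ^ 2 * Real.cos θ, e ^ 2 * Real.sin θ; -(e * Real.sin θ), e * Real.cos θ]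

theorem shearletMatrix_transpose_mul {e : ℝ} (he : 0 < e) (k : ℤ) (cone : Fin 2) :
    (shearletMatrix e k cone).transpose * shearletDual e k cone = 1 := by
  unfold shearletMatrix shearletDual
  ext i j
  split_ifs <;> fin_cases i <;> fin_cases j <;>
    simp [Matrix.mul_apply, Fin.sum_univ_two] <;> field_simp <;> ring

theorem curveletMatrix_transpose_mul {e : ℝ} (he : 0 < e) (θ : ℝ) :
    (curveletMatrix e θ).transpose * curveletDual e θ = 1 := by
  unfold curveletMatrix curveletDual
  have h := Real.sin_sq_add_cos_sq θ
  ext i j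
  fin_cases i <;> fin_cases j <;>
    simp [Matrix.mul_apply, Fin.sum_univ_two] <;> field_simp <;> linarith

theorem abs_det_shearletMatrix {e : ℝ} (he : 0 < e) (k : ℤ) (cone : Fin 2) :
    |(shearletMatrix e k cone).det| = (e ^ 3)⁻¹ := by
  have h3 : (e ^ 2)⁻¹ * e⁻¹ = (e ^ 3)⁻¹ := by field_simp
  unfold shearletMatrix
  split_ifs
  · simp only [Matrix.det_fin_two_of, mul_zero, sub_zero, h3]
    rw [abs_of_pos (by positivity)]
  · simp only [Matrix.det_fin_two_of, mul_zero, zero_sub, h3, abs_neg]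
    rw [abs_of_pos (by positivity)]

theorem abs_det_curveletMatrix {e : ℝ} (he : 0 < e) (θ : ℝ) :
    |(curveletMatrix e θ).det| = (e ^ 3)⁻¹ := by
  have h : (curveletMatrix e θ).det = (e ^ 3)⁻¹ := by
    have h := Real.sin_sq_add_cos_sq θ
    simp only [curveletMatrix, Matrix.det_fin_two_of]
    field_simp
    linarith
  rw [h, abs_of_pos (by positivity)]

theorem shearlet_eq (W V : ℝ → ℂ) (η : ShearletIndex) :
    shearlet W V η = fun x => (((2 : ℝ) ^ (3 * (η.j : ℝ) / 4) : ℝ) : ℂ) *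
      invFourier (shearletProfile W V)
        (matAct (shearletMatrix (aspect η.j) η.k η.cone) x + -latticePoint η.m) := by
  ext x
  have e2 := two_pow_eq η.j
  have e1 : Real.sqrt (aspect η.j ^ 2) = aspect η.j := Real.sqrt_sq (aspect_pos η.j).le
  by_cases h : η.cone = 0
  · simp only [shearlet, horizontalShearlet, if_pos h, shearletMatrix, shearletGenerator]
    rw [← sub_eq_add_neg]
    congr 3
    ext i
    fin_cases i <;>
      simp [matAct_apply, shearMatrix, parabolicMatrix, e1, e2, mul_assoc]
  · simp only [shearlet, horizontalShearlet, if_neg h, shearletMatrix, shearletGenerator]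
    rw [← sub_eq_add_neg]
    congr 3
    ext i
    fin_cases i <;>
      simp [matAct_apply, shearMatrix, parabolicMatrix, e1, e2, mul_assoc, add_comm]

/-- The point on the left is `ξ` multiplied by `r e^{-iθ}`, and arguments add modulo `2π`. -/
theorem arg_rotation_eq_angleFrom {ξ : Plane} (hξ : ξ ≠ 0) (θ : ℝ) {r : ℝ} (hr : 0 < r) :
    Complex.arg ⟨r * (Real.cos θ * ξ 0 + Real.sin θ * ξ 1),
      r * (-(Real.sin θ * ξ 0) + Real.cos θ * ξ 1)⟩ = angleFrom θ ξ := by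
  have hz : (⟨ξ 0, ξ 1⟩ : ℂ) ≠ 0 := by
    intro h
    apply hξ
    ext i
    fin_cases i
    exacts [congrArg Complex.re h, congrArg Complex.im h]
  have hu : ((r : ℂ) * ((Real.cos (-θ) : ℂ) + (Real.sin (-θ) : ℂ) * Complex.I)) ≠ 0 := by
    refine mul_ne_zero (by exact_mod_cast hr.ne') ?_
    rw [Complex.ofReal_cos, Complex.ofReal_sin, ← Complex.exp_mul_I]
    exact Complex.exp_ne_zero _
  have hmul : (⟨r * (Real.cos θ * ξ 0 + Real.sin θ * ξ 1),
      r * (-(Real.sin θ * ξ 0) + Real.cos θ * ξ 1)⟩ : ℂ) =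
      ⟨ξ 0, ξ 1⟩ * ((r : ℂ) * ((Real.cos (-θ) : ℂ) +
        (Real.sin (-θ) : ℂ) * Complex.I)) := by
    rw [Real.cos_neg, Real.sin_neg]
    apply Complex.ext <;> simp [-Complex.ofReal_cos, -Complex.ofReal_sin] <;> ring
  have h := Complex.arg_mul_coe_angle hz hu
  have h' := Complex.arg_mul_cos_add_sin_mul_I_coe_angle hr ((-θ : ℝ) : Real.Angle)
  simp only [Real.Angle.cos_coe, Real.Angle.sin_coe] at h'
  rw [← hmul, h'] at h
  rw [angleFrom, sub_eq_add_neg, ← Real.Angle.coe_neg, ← h, Complex.arg_coe_angle_toReal_eq_arg]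

theorem curveletHat_eq {W V : ℝ → ℂ} (hW : IsRadialWindow W) (hV : IsDirectionalWindow V)
    (μ : CurveletIndex) (ξ : Plane) :
    curveletHat W V μ ξ = (((2 : ℝ) ^ (-(3 * (μ.j : ℝ) / 4)) : ℝ) : ℂ) *
      affineHat (curveletDual (aspect μ.j) (curveletAngle μ.j μ.l)) (latticePoint μ.m)
        (fun ζ => curveletProfile W V (aspect μ.j, ζ)) ξ := by
  set e := aspect μ.j with he
  set θ := curveletAngle μ.j μ.l
  have hpos : 0 < e := aspect_pos _
  set ζ := matAct (curveletDual e θ) ξ with hζ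
  have z0 : ζ 0 = e ^ 2 * (Real.cos θ * ξ 0 + Real.sin θ * ξ 1) := by
    simp [hζ, matAct_apply, curveletDual]
    ring
  have z1 : ζ 1 = e * (-(Real.sin θ * ξ 0) + Real.cos θ * ξ 1) := by
    simp [hζ, matAct_apply, curveletDual]
    ring
  have hr : Real.sqrt (ζ 0 ^ 2 + e ^ 2 * ζ 1 ^ 2) = ‖ξ‖ / 2 ^ μ.j := by
    rw [EuclideanSpace.norm_eq, Fin.sum_univ_two, div_eq_mul_inv, ← aspect_sq, ← he,
      ← Real.sqrt_sq (sq_nonneg e), ← Real.sqrt_mul (by positivity)]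
    congr 1
    simp only [Real.norm_eq_abs, sq_abs]
    rw [z0, z1]
    have h := Real.sin_sq_add_cos_sq θ
    rw [Real.sqrt_sq (sq_nonneg e)]
    linear_combination e ^ 4 * (ξ 0 ^ 2 + ξ 1 ^ 2) * h
  have hin : inner ℝ (matAct (rotationMatrix θ)
      (matAct (parabolicMatrix ((2 : ℝ) ^ μ.j)⁻¹) (latticePoint μ.m))) ξ =
      inner ℝ (latticePoint μ.m) ζ := by
    rw [inner_plane, inner_plane, z0, z1]
    simp only [matAct_apply, rotationMatrix, parabolicMatrix, ← aspect_sq, ← he, Real.sqrt_sq hpos.le]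
    simp
    ring
  rw [curveletHat, affineHat, ← hζ, hin, ← curveletProfile_eq hW hV hpos (aspect_le_one _), hr,
    rpow_half_eq]
  -- The polar angle is meaningless at the origin, so the two angular factors need not agree there;
  -- `W 0 = 0` kills both sides.
  by_cases hξ : ξ = 0
  · have : W 0 = 0 := by
      by_contra h
      have := (hW.abs_mem h).1
      norm_num at this
    simp [hξ, this]
  · have harg : Complex.arg ⟨ζ 0, e * ζ 1⟩ = angleFrom θ ξ := by
      rw [← arg_rotation_eq_angleFrom hξ θ (r := e ^ 2) (by positivity), z0, z1]
      congr 2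
      ring
    rw [harg]
    ring

/-- The Jacobian `2^{3j/2}` turns the frequency normalisation `2^{-3j/4}` into `2^{3j/4}`. -/
theorem curvelet_eq {W V : ℝ → ℂ} (hW : IsRadialWindow W) (hV : IsDirectionalWindow V)
    (μ : CurveletIndex) :
    curvelet W V μ = fun x => (((2 : ℝ) ^ (3 * (μ.j : ℝ) / 4) : ℝ) : ℂ) *
      invFourier (fun ζ => curveletProfile W V (aspect μ.j, ζ))
        (matAct (curveletMatrix (aspect μ.j) (curveletAngle μ.j μ.l)) x + latticePoint μ.m) := by
  ext x
  have h1 := invFourier_comp_matAct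
    (curveletMatrix_transpose_mul (aspect_pos μ.j) (curveletAngle μ.j μ.l))
    (fun ζ => curveletProfile W V (aspect μ.j, ζ)) (latticePoint μ.m) x
  have h2 : (2 : ℝ) ^ (3 * (μ.j : ℝ) / 4) =
      (2 : ℝ) ^ (-(3 * (μ.j : ℝ) / 4)) * (aspect μ.j ^ 3)⁻¹ := by
    rw [← rpow_three_fourths_sq, Real.rpow_neg (by norm_num)]
    have : (2 : ℝ) ^ (3 * (μ.j : ℝ) / 4) ≠ 0 := by positivity
    field_simp
  have h3 : curvelet W V μ x = (((2 : ℝ) ^ (-(3 * (μ.j : ℝ) / 4)) : ℝ) : ℂ) *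
      invFourier (affineHat (curveletDual (aspect μ.j) (curveletAngle μ.j μ.l)) (latticePoint μ.m)
        (fun ζ => curveletProfile W V (aspect μ.j, ζ))) x := by
    simp only [curvelet, invFourier, curveletHat_eq hW hV, mul_assoc, integral_const_mul]
    ring
  rw [h3, h2]
  unfold affineHat
  rw [h1, abs_det_curveletMatrix (aspect_pos _)]
  push_cast
  ring

/-! ### Geometry of the transition matrix. -/

/-- The orientation of a curvelet as seen from the axis of a shearlet cone. -/
noncomputable def coneAngle (cone : Fin 2) (θ : ℝ) : ℝ := if cone = 0 then θ else Real.pi / 2 - θ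

/-- The matrix taking the affine coordinates of a shearlet to those of a curvelet. -/
noncomputable def crossMatrix (e e' φ : ℝ) (k : ℤ) (δ : ℝ) : Matrix (Fin 2) (Fin 2) ℝ :=
  !![(e / e') ^ 2 * Real.cos φ, e / e' ^ 2 * (Real.sin φ - k * e * Real.cos φ);
    -(δ * (e ^ 2 / e') * Real.sin φ), δ * (e / e') * (Real.cos φ + k * e * Real.sin φ)]

/-- The orientation sign of a cone. -/
noncomputable def coneSign (cone : Fin 2) : ℝ := if cone = 0 then 1 else -1

theorem coneSign_sq (cone : Fin 2) : coneSign cone ^ 2 = 1 := by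
  unfold coneSign
  split_ifs <;> norm_num

/-- Exchanging coordinates is a reflection: it replaces `θ` by `π/2 - θ` and reverses orientation,
whence the sign. Both cones are thereby treated at once. -/
theorem crossMatrix_mul {e e' : ℝ} (he : 0 < e) (he' : 0 < e') (θ : ℝ) (k : ℤ) (cone : Fin 2) :
    crossMatrix e e' (coneAngle cone θ) k (coneSign cone) * shearletMatrix e k cone =
      curveletMatrix e' θ := by
  unfold crossMatrix shearletMatrix curveletMatrix coneAngle coneSign
  ext i j
  split_ifs <;> fin_cases i <;> fin_cases j <;>
    simp [Matrix.mul_apply, Fin.sum_univ_two, Real.cos_pi_div_two_sub, Real.sin_pi_div_two_sub] <;>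
    field_simp <;> ring

theorem det_crossMatrix {e e' : ℝ} (he : 0 < e) (he' : 0 < e') (φ : ℝ) (k : ℤ) (δ : ℝ) :
    (crossMatrix e e' φ k δ).det = δ * (e / e') ^ 3 := by
  have h := Real.sin_sq_add_cos_sq φ
  rw [crossMatrix, Matrix.det_fin_two_of]
  field_simp
  linear_combination δ * h

/-- Put `q = e/e'` and `v = Tᵀ ζ`. The coefficients of `v 0` are at most `q²`, so `|v 0| ≥ 1/2`
bounds `q` below. Inverting the linear system expresses `q² ζ 0` through the bounded `v`, and `ζ 0 ≥
1/10` bounds `q` above. The equation for `v 1` then controls the one dangerous entry, which carries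
the factor `1/e'` and hence makes the slope mismatch small. -/
theorem crossMatrix_bounds {e e' : ℝ} (he : 0 < e) (he1 : e ≤ 1) (he' : 0 < e') (he1' : e' ≤ 1)
    {φ δ : ℝ} {k : ℤ} (hk : |k * e| ≤ 2) (hδ : δ ^ 2 = 1) {ζ : Plane}
    (h0 : 1 / 10 ≤ ζ 0) (h0' : ζ 0 ≤ 12 / 5) (h1 : |ζ 1| ≤ 5)
    (hv0 : 1 / 2 ≤ |matAct (crossMatrix e e' φ k δ).transpose ζ 0|)
    (hv0' : |matAct (crossMatrix e e' φ k δ).transpose ζ 0| ≤ 2)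
    (hv1 : |matAct (crossMatrix e e' φ k δ).transpose ζ 1| ≤ 2) :
    1 / 4 ≤ e / e' ∧ e / e' ≤ 9 ∧ (∀ i j, |crossMatrix e e' φ k δ i j| ≤ 1370) ∧
      |Real.sin φ - k * e * Real.cos φ| ≤ 21920 * e ∧
      |Real.sin φ - k * e * Real.cos φ| ≤ 5480 * e' := by
  set a := Real.cos φ with ha
  set b := Real.sin φ with hb
  set κ : ℝ := k * e
  set q := e / e' with hq
  have hqpos : 0 < q := by positivity
  have heq : e = q * e' := by rw [hq]; field_simp
  have hab : b ^ 2 + a ^ 2 = 1 := Real.sin_sq_add_cos_sq φ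
  have ha1 : |a| ≤ 1 := Real.abs_cos_le_one φ
  have hb1 : |b| ≤ 1 := Real.abs_sin_le_one φ
  have hδ1 : |δ| = 1 := by rw [← sq_abs] at hδ; nlinarith [abs_nonneg δ]
  have hζ0 : |ζ 0| ≤ 12 / 5 := by rw [abs_of_pos (by linarith)]; exact h0'
  have T00 : crossMatrix e e' φ k δ 0 0 = q ^ 2 * a := rfl
  have T01 : crossMatrix e e' φ k δ 0 1 = q / e' * (b - κ * a) := by
    change e / e' ^ 2 * (b - κ * a) = _
    rw [hq]
    field_simp
  have T10 : crossMatrix e e' φ k δ 1 0 = -(δ * (q * e) * b) := by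
    change -(δ * (e ^ 2 / e') * b) = _
    rw [hq]
    ring
  have T11 : crossMatrix e e' φ k δ 1 1 = δ * q * (a + κ * b) := rfl
  set v := matAct (crossMatrix e e' φ k δ).transpose ζ with hv
  have v0 : v 0 = q ^ 2 * a * ζ 0 + -(δ * (q * e) * b) * ζ 1 := by
    rw [hv, matAct_apply, Matrix.transpose_apply, Matrix.transpose_apply, T00, T10]
  have v1 : v 1 = q / e' * (b - κ * a) * ζ 0 + δ * q * (a + κ * b) * ζ 1 := by
    rw [hv, matAct_apply, Matrix.transpose_apply, Matrix.transpose_apply, T01, T11]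
  have t10 : |-(δ * (q * e) * b)| ≤ q ^ 2 := by
    rw [abs_neg, abs_mul, abs_mul, hδ1, one_mul, abs_of_pos (by positivity)]
    calc q * e * |b| ≤ q * (q * 1) * 1 := by
          gcongr
          rw [heq]
          gcongr
      _ = q ^ 2 := by ring
  have t00 : |q ^ 2 * a| ≤ q ^ 2 := by
    rw [abs_mul, abs_of_pos (by positivity)]
    calc q ^ 2 * |a| ≤ q ^ 2 * 1 := by gcongr
      _ = q ^ 2 := by ring
  have hs : |a + κ * b| ≤ 3 := by
    calc |a + κ * b| ≤ |a| + |κ| * |b| := by rw [← abs_mul]; exact abs_add_le _ _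
      _ ≤ 1 + 2 * 1 := by gcongr
      _ = 3 := by norm_num
  have q_lower : 1 / 4 ≤ q := by
    have : |v 0| ≤ q ^ 2 * (12 / 5) + q ^ 2 * 5 := by
      rw [v0]
      refine (abs_add_le _ _).trans ?_
      rw [abs_mul (q ^ 2 * a), abs_mul _ (ζ 1)]
      gcongr
    by_contra hn
    have := pow_lt_pow_left₀ (not_le.1 hn) hqpos.le two_ne_zero
    norm_num at this
    linarith
  have q_upper : q ≤ 9 := by
    -- The combination of `v 0` and `v 1` is the one that eliminates `ζ 1`.
    have id : q ^ 2 * ζ 0 = (a + κ * b) * v 0 + e * b * v 1 := by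
      rw [v0, v1]
      have : e * (q / e') = q ^ 2 := by rw [hq]; ring
      linear_combination (-q ^ 2 * ζ 0) * hab - b * (b - κ * a) * ζ 0 * this
    have : |q ^ 2 * ζ 0| ≤ 3 * 2 + 1 * 1 * 2 := by
      rw [id]
      refine (abs_add_le _ _).trans ?_
      rw [abs_mul (a + κ * b), abs_mul _ (v 1), abs_mul e, abs_of_pos he]
      gcongr
    rw [abs_of_pos (by positivity)] at this
    by_contra hn
    have h81 := pow_lt_pow_left₀ (not_le.1 hn) (by norm_num) two_ne_zero
    norm_num at h81
    have := mul_le_mul_of_nonneg_left h0 (sq_nonneg q)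
    linarith
  have t11 : |δ * q * (a + κ * b)| ≤ 27 := by
    rw [abs_mul, abs_mul, hδ1, one_mul, abs_of_pos hqpos]
    calc q * |a + κ * b| ≤ 9 * 3 := by gcongr
      _ = 27 := by norm_num
  -- The bound is `(2 + 27 · 5) / (1/10)`. Below, `q ≥ 1/4` turns it into `4 · 1370 = 5480`, and `e'
  -- ≤ 4e` into `21920`.
  have t01 : |q / e' * (b - κ * a)| ≤ 1370 := by
    have e1 : q / e' * (b - κ * a) * ζ 0 = v 1 - δ * q * (a + κ * b) * ζ 1 := by rw [v1]; ring
    have e2 : |q / e' * (b - κ * a)| * ζ 0 ≤ 2 + 27 * 5 := by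
      rw [← abs_of_pos (by linarith : 0 < ζ 0), ← abs_mul, e1]
      refine (abs_sub _ _).trans ?_
      rw [abs_mul _ (ζ 1)]
      gcongr
    have := mul_le_mul_of_nonneg_left h0 (abs_nonneg (q / e' * (b - κ * a)))
    linarith
  have hq2 : q ^ 2 ≤ 81 := (pow_le_pow_left₀ hqpos.le q_upper 2).trans (by norm_num)
  have hbe : |b - κ * a| ≤ 5480 * e' := by
    rw [abs_mul, abs_of_pos (by positivity), div_mul_eq_mul_div, div_le_iff₀ he'] at t01
    have := mul_le_mul_of_nonneg_right q_lower (abs_nonneg (b - κ * a))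
    linarith
  refine ⟨q_lower, q_upper, ?_, ?_, hbe⟩
  · intro i j
    fin_cases i <;> fin_cases j
    · exact (T00 ▸ t00).trans (by linarith)
    · exact T01 ▸ t01
    · exact (T10 ▸ t10).trans (by linarith)
    · exact (T11 ▸ t11).trans (by norm_num)
  · refine hbe.trans ?_
    have := mul_le_mul_of_nonneg_right q_lower he'.le
    rw [← heq] at this
    linarith

/-! ### Lattice sums and elementary estimates. -/

/-- The summable weight `(1 + x²)⁻¹`. -/
noncomputable def latticeWeight (x : ℝ) : ℝ≥0∞ := ENNReal.ofReal (1 + x ^ 2)⁻¹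

/-- This replaces counting the integers near a centre by summing a weight, so that scales,
orientations and positions are all handled by the same series bound. -/
theorem one_le_mul_latticeWeight {x D : ℝ} (h : |x| ≤ D) :
    1 ≤ ENNReal.ofReal (1 + D ^ 2) * latticeWeight x := by
  rw [latticeWeight, ← ENNReal.ofReal_mul (by positivity), ENNReal.one_le_ofReal,
    ← div_eq_mul_inv, one_le_div (by positivity)]
  have := sq_le_sq' (abs_le.1 h).1 (abs_le.1 h).2
  linarith

/-- Shifting by `⌊x⌋` reduces to `0 ≤ x < 1`, where `1 + n² ≤ 3 (1 + (n - x)²)`. -/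
theorem exists_tsum_latticeWeight_le :
    ∃ C : ℝ≥0∞, C ≠ ⊤ ∧ ∀ x : ℝ, ∑' n : ℤ, latticeWeight (n - x) ≤ C := by
  have hs : Summable (fun n : ℤ => (1 + (n : ℝ) ^ 2)⁻¹) := by
    refine Summable.of_norm_bounded_eventually (g := fun n : ℤ => 1 / (n : ℝ) ^ 2)
      (Real.summable_one_div_int_pow.2 (by norm_num)) ?_
    filter_upwards [(Set.finite_singleton (0 : ℤ)).compl_mem_cofinite] with n hn
    have hn' : (n : ℝ) ≠ 0 := by exact_mod_cast hn
    rw [Real.norm_of_nonneg (by positivity), one_div]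
    gcongr
    linarith
  refine ⟨3 * ∑' n : ℤ, ENNReal.ofReal (1 + (n : ℝ) ^ 2)⁻¹,
    ENNReal.mul_ne_top ENNReal.ofNat_ne_top hs.tsum_ofReal_ne_top, fun x => ?_⟩
  rw [← ENNReal.tsum_mul_left, ← (Equiv.addRight ⌊x⌋).tsum_eq]
  refine ENNReal.tsum_le_tsum fun n => ?_
  have h3 : (3 : ℝ≥0∞) = ENNReal.ofReal 3 := by simp
  rw [latticeWeight, h3, ← ENNReal.ofReal_mul (by norm_num)]
  apply ENNReal.ofReal_le_ofReal
  have hx0 := Int.fract_nonneg x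
  have hx1 := (Int.fract_lt_one x).le
  have hx : ((Equiv.addRight ⌊x⌋ n : ℤ) : ℝ) - x = n - Int.fract x := by
    rw [Equiv.coe_addRight, Int.fract]
    push_cast
    ring
  rw [hx, ← div_eq_mul_inv, le_div_iff₀ (by positivity), inv_mul_le_iff₀ (by positivity)]
  nlinarith [sq_nonneg ((n : ℝ) - 2 * Int.fract x)]

theorem tsum_nat_latticeWeight_le (x : ℝ) :
    ∑' n : ℕ, latticeWeight (n - x) ≤ ∑' n : ℤ, latticeWeight (n - x) := by
  have := ENNReal.tsum_comp_le_tsum_of_injective (Nat.cast_injective (R := ℤ))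
    (fun n : ℤ => latticeWeight (n - x))
  simpa using this

theorem tsum_prod_latticeWeight (x y : ℝ) :
    ∑' m : ℤ × ℤ, latticeWeight (m.1 - x) * latticeWeight (m.2 - y) =
      (∑' n : ℤ, latticeWeight (n - x)) * ∑' n : ℤ, latticeWeight (n - y) := by
  rw [ENNReal.tsum_prod']
  simp_rw [ENNReal.tsum_mul_left]
  rw [ENNReal.tsum_mul_right]

/-- The inner bounds are uniform in the outer variables because the centres of the inner weights
depend on those variables. -/
theorem tsum_triple_le {α β γ : Type*} (f : α → ℝ≥0∞) (g : α → β → ℝ≥0∞)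
    (h : α → β → γ → ℝ≥0∞) {a b c : ℝ≥0∞} (hf : ∑' x, f x ≤ a) (hg : ∀ x, ∑' y, g x y ≤ b)
    (hh : ∀ x y, ∑' z, h x y z ≤ c) :
    ∑' i : α × β × γ, f i.1 * g i.1 i.2.1 * h i.1 i.2.1 i.2.2 ≤ a * b * c := by
  rw [ENNReal.tsum_prod']
  calc ∑' x, ∑' i : β × γ, f x * g x i.1 * h x i.1 i.2 ≤ ∑' x, f x * b * c := by
        refine ENNReal.tsum_le_tsum fun x => ?_
        rw [ENNReal.tsum_prod']
        calc ∑' y, ∑' z, f x * g x y * h x y z ≤ ∑' y, f x * g x y * c := by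
              refine ENNReal.tsum_le_tsum fun y => ?_
              rw [ENNReal.tsum_mul_left]
              gcongr
              exact hh x y
          _ ≤ f x * b * c := by
              rw [ENNReal.tsum_mul_right, ENNReal.tsum_mul_left]
              gcongr
              exact hg x
    _ ≤ a * b * c := by
        rw [ENNReal.tsum_mul_right, ENNReal.tsum_mul_right]
        gcongr

/-- Take the nearest multiple of `π` and apply Jordan's inequality `(2/π)|y| ≤ |sin y|` to the
remainder. -/
theorem exists_int_abs_sub_mul_pi_le (x : ℝ) :
    ∃ n : ℤ, |x - n * Real.pi| ≤ Real.pi / 2 * |Real.sin x| ∧ |x - n * Real.pi| ≤ Real.pi / 2 := by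
  refine ⟨round (x / Real.pi), ?_⟩
  have hpi := Real.pi_pos
  set n := round (x / Real.pi)
  have h : |x - n * Real.pi| ≤ Real.pi / 2 := by
    have h1 := abs_sub_round (x / Real.pi)
    have h2 : x - n * Real.pi = (x / Real.pi - n) * Real.pi := by field_simp
    rw [h2, abs_mul, abs_of_pos hpi]
    nlinarith
  refine ⟨?_, h⟩
  have h1 := Real.mul_abs_le_abs_sin h
  rw [Real.sin_sub_int_mul_pi, abs_mul, abs_zpow, abs_neg, abs_one, one_zpow, one_mul] at h1
  rw [div_mul_eq_mul_div, div_le_iff₀ hpi] at h1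
  linarith

/-! ### Overlap of frequency supports and the entrywise bound. -/

/-- The matrix taking the affine coordinates of a shearlet with parameters `(j, k, cone)` to those
of a curvelet with parameters `(j', l)`. -/
noncomputable def transition (j : ℕ) (k : ℤ) (cone : Fin 2) (j' l : ℕ) :
    Matrix (Fin 2) (Fin 2) ℝ :=
  crossMatrix (aspect j) (aspect j') (coneAngle cone (curveletAngle j' l)) k (coneSign cone)

/-- The relative position of the shearlet `η` and the curvelet `μ`, in curvelet coordinates. -/
noncomputable def offset (η : ShearletIndex) (μ : CurveletIndex) : Plane :=
  latticePoint μ.m + matAct (transition η.j η.k η.cone μ.j μ.l) (latticePoint η.m)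

/-- Quantitative consequences of an overlap of the frequency supports of `η` and `μ`. -/
structure Overlap (η : ShearletIndex) (μ : CurveletIndex) : Prop where
  ratio_lower : 1 / 4 ≤ aspect η.j / aspect μ.j
  ratio_upper : aspect η.j / aspect μ.j ≤ 9
  entry_le : ∀ i j, |transition η.j η.k η.cone μ.j μ.l i j| ≤ 1370
  slope_le : |Real.sin (coneAngle η.cone (curveletAngle μ.j μ.l)) -
    η.k * aspect η.j * Real.cos (coneAngle η.cone (curveletAngle μ.j μ.l))| ≤ 21920 * aspect η.j
  slope_le' : |Real.sin (coneAngle η.cone (curveletAngle μ.j μ.l)) -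
    η.k * aspect η.j * Real.cos (coneAngle η.cone (curveletAngle μ.j μ.l))| ≤ 5480 * aspect μ.j

theorem ShearletIndex.abs_k_mul_aspect_le (η : ShearletIndex) : |(η.k : ℝ) * aspect η.j| ≤ 2 := by
  have he := aspect_pos η.j
  have h1 : ((|η.k| : ℤ) : ℝ) ≤ (⌈(2 : ℝ) ^ ((η.j : ℝ) / 2)⌉ : ℤ) := by exact_mod_cast η.abs_k_le
  have h2 := (Int.ceil_lt_add_one ((2 : ℝ) ^ ((η.j : ℝ) / 2))).le
  rw [rpow_half_eq] at h1 h2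
  rw [abs_mul, abs_of_pos he]
  have h3 : |(η.k : ℝ)| ≤ (aspect η.j)⁻¹ + 1 := by
    push_cast at h1
    exact h1.trans h2
  calc |(η.k : ℝ)| * aspect η.j ≤ ((aspect η.j)⁻¹ + 1) * aspect η.j := by gcongr
    _ = 1 + aspect η.j := by field_simp
    _ ≤ 2 := by linarith [aspect_le_one η.j]

theorem curveletAngle_eq (j l : ℕ) : curveletAngle j l = 2 * Real.pi * l * aspect j := by
  rw [curveletAngle, aspect, div_eq_mul_inv]

theorem exists_decay_invFourier {F : Plane → ℂ} (hF : ContDiff ℝ ∞ F) (hc : HasCompactSupport F)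
    (N : ℕ) : ∃ C : ℝ, ∀ x, (1 + ‖x‖) ^ N * ‖invFourier F x‖ ≤ C := by
  have h := SchwartzMap.one_add_le_sup_seminorm_apply (𝕜 := ℂ) (m := (N, 0)) (k := N) (n := 0)
    le_rfl le_rfl (invFourierSchwartz (hc.toSchwartzMap hF))
  simp only [norm_iteratedFDeriv_zero, invFourierSchwartz_apply] at h
  exact ⟨_, h⟩

theorem exists_crossGramian_bound {W V W' V' : ℝ → ℂ} (hW : IsRadialWindow W)
    (hV : IsDirectionalWindow V) (hW' : IsRadialWindow W') (hV' : IsDirectionalWindow V') (N : ℕ) :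
    ∃ C : ℝ, 0 ≤ C ∧ ∀ η μ, l2Inner (shearlet W V η) (curvelet W' V' μ) = 0 ∨
      (Overlap η μ ∧
        ‖l2Inner (shearlet W V η) (curvelet W' V' μ)‖ ≤ C * ((1 + ‖offset η μ‖) ^ N)⁻¹) := by
  obtain ⟨C, hC⟩ := exists_decay_invFourier (contDiff_shearletProfile hW hV)
    (hasCompactSupport_shearletProfile hW hV) (N + 3)
  obtain ⟨D, hD⟩ := exists_uniform_decay_invFourier (contDiff_curveletProfile hW' hV')
    (hasCompactSupport_curveletProfile W' V') N
  have hC0 : 0 ≤ C := le_trans (by positivity) (hC 0)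
  have hD0 : 0 ≤ D := le_trans (by positivity) (hD 0 0)
  set I := ∫ x : Plane, (1 + ‖x‖) ^ (-3 : ℝ)
  have hI : 0 ≤ I := integral_nonneg fun x => by positivity
  -- The normalisations contribute `2^{3j/4} 2^{3j'/4} |det B|⁻¹ = (e/e')^{3/2} ≤ 9^{3/2} = 27`.
  refine ⟨27 * (C * D * (1 + 4 * 1370) ^ N * I), by positivity, fun η μ => ?_⟩
  set e := aspect η.j
  set e' := aspect μ.j
  have he : 0 < e := aspect_pos _
  have he' : 0 < e' := aspect_pos _
  have hT := crossMatrix_mul he he' (curveletAngle μ.j μ.l) η.k η.cone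
  rw [shearlet_eq, curvelet_eq hW' hV']
  by_cases h : ∀ ζ, shearletProfile W V (matAct (transition η.j η.k η.cone μ.j μ.l).transpose ζ) = 0 ∨
      curveletProfile W' V' (e', ζ) = 0
  · left
    exact l2Inner_affine_eq_zero (shearletMatrix_transpose_mul he η.k η.cone)
      (curveletMatrix_transpose_mul he' (curveletAngle μ.j μ.l)) hT (-latticePoint η.m)
      (latticePoint μ.m) (contDiff_shearletProfile hW hV) (hasCompactSupport_shearletProfile hW hV)
      (contDiff_curveletProfile_slice hW' hV' _) (hasCompactSupport_curveletProfile_slice W' V' _)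
      h _ _
  · right
    push Not at h
    obtain ⟨ζ, h1, h2⟩ := h
    obtain ⟨-, z0, z0', z1⟩ := curveletProfile_ne_zero h2
    obtain ⟨v0, v0', v1⟩ := shearletProfile_ne_zero hW hV h1
    obtain ⟨b1, b2, b3, b4, b5⟩ := crossMatrix_bounds he (aspect_le_one _) he' (aspect_le_one _)
      η.abs_k_mul_aspect_le (coneSign_sq η.cone) z0 z0' z1 v0 v0' v1
    refine ⟨⟨b1, b2, b3, b4, b5⟩, ?_⟩
    have hdet : (shearletMatrix e η.k η.cone).det ≠ 0 := by
      rw [← abs_ne_zero, abs_det_shearletMatrix he]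
      positivity
    have hb := norm_l2Inner_affine_le hdet hT b3 (-latticePoint η.m) (latticePoint μ.m) hC (hD e')
      (((2 : ℝ) ^ (3 * (η.j : ℝ) / 4) : ℝ) : ℂ) (((2 : ℝ) ^ (3 * (μ.j : ℝ) / 4) : ℝ) : ℂ)
    have hoff : latticePoint μ.m - matAct (transition η.j η.k η.cone μ.j μ.l) (-latticePoint η.m) = offset η μ := by
      have := map_neg (Matrix.toLpLin 2 2 (transition η.j η.k η.cone μ.j μ.l)) (latticePoint η.m)
      change matAct _ (-latticePoint η.m) = -matAct _ (latticePoint η.m) at this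
      rw [this, sub_neg_eq_add, offset]
    change _ ≤ _ * ((1 + ‖latticePoint μ.m - matAct (transition η.j η.k η.cone μ.j μ.l) (-latticePoint η.m)‖) ^ N)⁻¹
      at hb
    rw [hoff] at hb
    refine hb.trans ?_
    gcongr
    rw [Complex.norm_real, Complex.norm_real, abs_det_shearletMatrix he, inv_inv,
      Real.norm_of_nonneg (by positivity), Real.norm_of_nonneg (by positivity)]
    refine le_of_sq_le_sq ?_ (by norm_num)
    rw [mul_pow, mul_pow, rpow_three_fourths_sq, rpow_three_fourths_sq]
    have : (e ^ 3)⁻¹ * (e' ^ 3)⁻¹ * (e ^ 3) ^ 2 = (e / e') ^ 3 := by field_simp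
    change (e ^ 3)⁻¹ * (e' ^ 3)⁻¹ * (e ^ 3) ^ 2 ≤ _
    rw [this]
    exact (pow_le_pow_left₀ (by positivity) b2 3).trans (by norm_num)

/-! ### Scales and orientations that can interact. -/

/-- The squared aspect ratio is `2^{j'-j}`, and it lies between `1/16 = 2^{-4}` and `81 < 2^7`. -/
theorem Overlap.scale_le {η : ShearletIndex} {μ : CurveletIndex} (h : Overlap η μ) :
    |(μ.j : ℝ) - η.j| ≤ 6 := by
  have he := aspect_pos η.j
  have he' := aspect_pos μ.j
  have h1 := h.ratio_lower
  have h2 := h.ratio_upper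
  rw [le_div_iff₀ he'] at h1
  rw [div_le_iff₀ he'] at h2
  have s1 := pow_le_pow_left₀ (by positivity) h1 2
  have s2 := pow_le_pow_left₀ he.le h2 2
  rw [mul_pow, aspect_sq, aspect_sq] at s1 s2
  have u1 : (2 : ℝ) ^ η.j ≤ 2 ^ (μ.j + 4) := by
    rw [← div_eq_mul_inv, div_le_iff₀ (by positivity), inv_mul_eq_div, le_div_iff₀ (by positivity)]
      at s1
    rw [pow_add]
    linarith
  have u2 : (2 : ℝ) ^ μ.j < 2 ^ (η.j + 7) := by
    rw [← div_eq_mul_inv, le_div_iff₀ (by positivity), inv_mul_eq_div, div_le_iff₀ (by positivity)]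
      at s2
    rw [pow_add]
    have : (0 : ℝ) < 2 ^ η.j := by positivity
    linarith
  have v1 : η.j ≤ μ.j + 4 := (pow_le_pow_iff_right₀ (by norm_num)).1 u1
  have v2 : μ.j < η.j + 7 := (pow_lt_pow_iff_right₀ (by norm_num)).1 u2
  have w1 : (η.j : ℝ) ≤ μ.j + 4 := by exact_mod_cast v1
  have w2 : (μ.j : ℝ) ≤ η.j + 6 := by exact_mod_cast Nat.lt_succ_iff.1 v2
  rw [abs_le]
  constructor <;> linarith

/-- The possible orientations of curvelets at scale `j` that interact with a given shearlet
cluster around these centers. -/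
noncomputable def orientationCenter (η : ShearletIndex) (j : ℕ) (n : ℤ) : ℝ :=
  if η.cone = 0 then (Real.arctan (η.k * aspect η.j) + n * Real.pi) / (2 * Real.pi * aspect j)
  else (Real.pi / 2 - Real.arctan (η.k * aspect η.j) - n * Real.pi) / (2 * Real.pi * aspect j)

/-- With `α = arctan κ`, `sin(φ - α) = cos α (sin φ - κ cos φ)` is of order `e'`, so `φ` is that
close to some `α + nπ`. As `φ` ranges over a bounded interval, few `n` occur. -/
theorem Overlap.exists_orientation_le {η : ShearletIndex} {μ : CurveletIndex} (h : Overlap η μ) :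
    ∃ n ∈ Finset.Icc (-3 : ℤ) 3, |(μ.l : ℝ) - orientationCenter η μ.j n| ≤ 1370 := by
  have hpi := Real.pi_pos
  set e' := aspect μ.j with he'_def
  have he' : 0 < e' := aspect_pos _
  set κ : ℝ := η.k * aspect η.j with hκ
  set θ := curveletAngle μ.j μ.l with hθ
  set φ := coneAngle η.cone θ with hφ
  have hθe : θ = 2 * Real.pi * μ.l * e' := curveletAngle_eq _ _
  have hle : (μ.l : ℝ) * e' < 1 := by
    have h1 := μ.l_lt
    rw [rpow_half_eq] at h1
    calc (μ.l : ℝ) * e' < e'⁻¹ * e' := by gcongr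
      _ = 1 := inv_mul_cancel₀ he'.ne'
  have hl0 : 0 ≤ (μ.l : ℝ) * e' := by positivity
  set α := Real.arctan κ with hα
  have hα1 := Real.neg_pi_div_two_lt_arctan κ
  have hα2 := Real.arctan_lt_pi_div_two κ
  have hcos := Real.cos_arctan_pos κ
  have hsin : Real.sin α = κ * Real.cos α := by
    have h1 := Real.tan_arctan κ
    rwa [Real.tan_eq_sin_div_cos, div_eq_iff hcos.ne'] at h1
  have hs : |Real.sin (φ - α)| ≤ 5480 * e' := by
    have h1 : Real.sin (φ - α) = Real.cos α * (Real.sin φ - κ * Real.cos φ) := by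
      rw [Real.sin_sub, hsin]
      ring
    rw [h1, abs_mul]
    calc |Real.cos α| * |Real.sin φ - κ * Real.cos φ| ≤ 1 * (5480 * e') := by
          gcongr
          exacts [Real.abs_cos_le_one α, h.slope_le']
      _ = _ := one_mul _
  obtain ⟨n, hn, hn'⟩ := exists_int_abs_sub_mul_pi_le (φ - α)
  have hn2 : |φ - α - n * Real.pi| ≤ Real.pi / 2 * (5480 * e') := hn.trans (by gcongr)
  have hθ0 : 0 ≤ θ := by rw [hθe]; positivity
  have hθ1 : θ ≤ 2 * Real.pi := by rw [hθe]; nlinarith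
  have hφ1 : -(3 / 2 * Real.pi) ≤ φ ∧ φ ≤ 2 * Real.pi := by
    rw [hφ, coneAngle]
    split_ifs <;> constructor <;> linarith
  rw [abs_le] at hn'
  refine ⟨n, Finset.mem_Icc.2 ⟨?_, ?_⟩, ?_⟩
  · by_contra hlt
    have h4 : (n : ℝ) ≤ -4 := by exact_mod_cast (by omega : n ≤ -4)
    nlinarith
  · by_contra hlt
    have h4 : (4 : ℝ) ≤ n := by exact_mod_cast (by omega : 4 ≤ n)
    nlinarith
  · have hd : 0 < 2 * Real.pi * e' := by positivity
    have key : |(μ.l : ℝ) - orientationCenter η μ.j n| * (2 * Real.pi * e') =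
        |φ - α - n * Real.pi| := by
      rw [← abs_of_pos hd, ← abs_mul, orientationCenter, hφ, coneAngle, ← he'_def, ← hκ, ← hα]
      split_ifs
      · rw [sub_mul, div_mul_cancel₀ _ hd.ne', hθe]
        congr 1
        ring
      · rw [sub_mul, div_mul_cancel₀ _ hd.ne', hθe, ← abs_neg]
        congr 1
        ring
    -- Dividing the angular error `(π/2) · 5480 e'` by the spacing `2π e'` of the curvelet angles
    -- gives `1370`.
    have h2 : |(μ.l : ℝ) - orientationCenter η μ.j n| * (2 * Real.pi * e') ≤
        1370 * (2 * Real.pi * e') := by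
      rw [key]
      linarith
    exact le_of_mul_le_mul_right h2 hd

/-- The shear parameters at scale `j` that interact with a given curvelet cluster around this
center, or else are bounded. -/
noncomputable def shearCenter (μ : CurveletIndex) (j : ℕ) (cone : Fin 2) : ℝ :=
  Real.sin (coneAngle cone (curveletAngle μ.j μ.l)) /
    (Real.cos (coneAngle cone (curveletAngle μ.j μ.l)) * aspect j)

/-- If `|cos φ| ≥ 1/10`, dividing the slope bound by `e cos φ` localises `k`. Otherwise `|sin φ| ≥
9/10` while `|κ cos φ| ≤ 2/10`, so the slope bound forces `e` to be bounded below; such coarse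
scales allow only bounded `k`. -/
theorem Overlap.shear_le {η : ShearletIndex} {μ : CurveletIndex} (h : Overlap η μ) :
    |(η.k : ℝ) - shearCenter μ η.j η.cone| ≤ 219200 ∨ |(η.k : ℝ)| ≤ 219200 := by
  have hs := h.slope_le
  have hk := η.abs_k_mul_aspect_le
  rw [shearCenter]
  set φ := coneAngle η.cone (curveletAngle μ.j μ.l)
  set e := aspect η.j
  have he : 0 < e := aspect_pos _
  rcases le_or_gt (1 / 10) |Real.cos φ| with hc | hc
  · left
    have hc0 : Real.cos φ ≠ 0 := abs_pos.1 (by linarith)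
    have key : |(η.k : ℝ) - Real.sin φ / (Real.cos φ * e)| * (|Real.cos φ| * e) =
        |Real.sin φ - η.k * e * Real.cos φ| := by
      rw [← abs_of_pos he, ← abs_mul, ← abs_mul, abs_of_pos he, ← abs_neg]
      congr 1
      field_simp
      ring
    have h1 := mul_le_mul_of_nonneg_left (mul_le_mul_of_nonneg_right hc he.le)
      (abs_nonneg ((η.k : ℝ) - Real.sin φ / (Real.cos φ * e)))
    rw [key] at h1
    have h2 : |(η.k : ℝ) - Real.sin φ / (Real.cos φ * e)| * e ≤ 219200 * e := by linarith
    exact le_of_mul_le_mul_right h2 he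
  · right
    have hsq := Real.sin_sq_add_cos_sq φ
    have hs9 : 9 / 10 ≤ |Real.sin φ| := by
      rw [← sq_abs (Real.sin φ), ← sq_abs (Real.cos φ)] at hsq
      nlinarith [abs_nonneg (Real.sin φ), abs_nonneg (Real.cos φ)]
    have h1 : |Real.sin φ| ≤ 21920 * e + 2 * (1 / 10) := by
      have h2 : Real.sin φ = (Real.sin φ - η.k * e * Real.cos φ) + η.k * e * Real.cos φ := by ring
      rw [h2]
      refine (abs_add_le _ _).trans (add_le_add hs ?_)
      rw [abs_mul]
      gcongr
    rw [abs_mul, abs_of_pos he] at hk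
    have h2 : |(η.k : ℝ)| * e ≤ 219200 * e := by linarith
    exact le_of_mul_le_mul_right h2 he

/-! ### Row and column sums. -/

/-- Decay of order four splits into one inverse square per coordinate. -/
theorem enorm_rpow_le_latticeWeight {C p : ℝ} (hC : 0 ≤ C) (hp : 0 < p) {N : ℕ} (hN : 4 ≤ N * p) {z : ℂ}
    {u : Plane} (hz : ‖z‖ ≤ C * ((1 + ‖u‖) ^ N)⁻¹) :
    ‖z‖ₑ ^ p ≤ ENNReal.ofReal (C ^ p) * (latticeWeight (u 0) * latticeWeight (u 1)) := by
  have hu : 1 ≤ 1 + ‖u‖ := by linarith [norm_nonneg u]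
  have hui : ∀ i, 1 + u i ^ 2 ≤ (1 + ‖u‖) ^ 2 := by
    intro i
    have h1 : |u i| ≤ ‖u‖ := PiLp.norm_apply_le u i
    have h2 := pow_le_pow_left₀ (abs_nonneg _) h1 2
    rw [sq_abs] at h2
    nlinarith [norm_nonneg u]
  have h1 : ‖z‖ ^ p ≤ C ^ p * ((1 + u 0 ^ 2)⁻¹ * (1 + u 1 ^ 2)⁻¹) := by
    calc ‖z‖ ^ p ≤ (C * ((1 + ‖u‖) ^ N)⁻¹) ^ p := by gcongr
      _ = C ^ p * ((1 + ‖u‖) ^ (N * p))⁻¹ := by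
          rw [Real.mul_rpow hC (by positivity), Real.inv_rpow (by positivity), ← Real.rpow_natCast,
            ← Real.rpow_mul (by positivity)]
      _ ≤ C ^ p * ((1 + ‖u‖) ^ (4 : ℝ))⁻¹ := by gcongr
      _ = C ^ p * (((1 + ‖u‖) ^ 2)⁻¹ * ((1 + ‖u‖) ^ 2)⁻¹) := by
          rw [← mul_inv, ← pow_add]
          norm_cast
      _ ≤ _ := by
          gcongr
          exacts [hui 0, hui 1]
  rw [latticeWeight, latticeWeight, ← ENNReal.ofReal_mul (by positivity),
    ← ENNReal.ofReal_mul (by positivity), ← ofReal_norm,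
    ENNReal.ofReal_rpow_of_nonneg (norm_nonneg _) hp.le]
  exact ENNReal.ofReal_le_ofReal h1

/-- In a column the shearlet position varies, and the offset runs over an image of `ℤ²` under `T`.
Applying `T⁻¹` restores a translate of `ℤ²`. By the adjugate formula and `|det T| ≥ 4⁻³` its entries
are at most `64 · 1370 = 87680`, and `350721 = 4 · 87680 + 1`. -/
theorem one_add_norm_le_of_transition {η : ShearletIndex} {μ : CurveletIndex} (h : Overlap η μ) :
    1 + ‖latticePoint η.m +
        matAct (transition η.j η.k η.cone μ.j μ.l)⁻¹ (latticePoint μ.m)‖ ≤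
      350721 * (1 + ‖offset η μ‖) := by
  set T := transition η.j η.k η.cone μ.j μ.l with hT
  have hdet : T.det = coneSign η.cone * (aspect η.j / aspect μ.j) ^ 3 :=
    det_crossMatrix (aspect_pos _) (aspect_pos _) _ _ _
  have hsign : |coneSign η.cone| = 1 := by
    have := coneSign_sq η.cone
    rw [← sq_abs] at this
    nlinarith [abs_nonneg (coneSign η.cone)]
  have habs : 1 / 64 ≤ |T.det| := by
    have hpos : 0 < aspect η.j / aspect μ.j := div_pos (aspect_pos _) (aspect_pos _)
    rw [hdet, abs_mul, hsign, one_mul, abs_of_pos (by positivity)]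
    have := pow_le_pow_left₀ (by norm_num) h.ratio_lower 3
    norm_num at this ⊢
    exact this
  have hne : T.det ≠ 0 := abs_pos.1 (by linarith)
  have hinv : |T.det|⁻¹ ≤ 64 := by
    rw [inv_le_comm₀ (by linarith) (by norm_num)]
    linarith
  have hentry : ∀ i j, |T⁻¹ i j| ≤ 87680 := by
    have hb : ∀ i j, |T.det⁻¹ * T i j| ≤ 87680 := by
      intro i j
      rw [abs_mul, abs_inv]
      calc |T.det|⁻¹ * |T i j| ≤ 64 * 1370 := by
            gcongr
            exact h.entry_le i j
        _ = 87680 := by norm_num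
    intro i j
    rw [Matrix.inv_def, Ring.inverse_eq_inv', Matrix.adjugate_fin_two]
    fin_cases i <;> fin_cases j
    · exact hb 1 1
    · simpa using hb 0 1
    · simpa using hb 1 0
    · exact hb 0 0
  have hoff : latticePoint η.m + matAct T⁻¹ (latticePoint μ.m) = matAct T⁻¹ (offset η μ) := by
    rw [offset, matAct_add, ← hT, ← matAct_mul,
      Matrix.nonsing_inv_mul _ (isUnit_iff_ne_zero.2 hne), matAct_one, add_comm]
  rw [hoff]
  have := norm_matAct_le hentry (offset η μ)
  linarith [norm_nonneg (offset η μ)]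

theorem latticeWeight_sub_comm (x y : ℝ) : latticeWeight (x - y) = latticeWeight (y - x) := by
  rw [latticeWeight, latticeWeight, ← neg_sub, neg_sq]

theorem Overlap.one_le_scale {η : ShearletIndex} {μ : CurveletIndex} (h : Overlap η μ) :
    1 ≤ ENNReal.ofReal (1 + 6 ^ 2) * latticeWeight (μ.j - η.j) :=
  one_le_mul_latticeWeight h.scale_le

theorem Overlap.one_le_orientation {η : ShearletIndex} {μ : CurveletIndex} (h : Overlap η μ) :
    1 ≤ ENNReal.ofReal (1 + 1370 ^ 2) *
      ∑ n ∈ Finset.Icc (-3 : ℤ) 3, latticeWeight (μ.l - orientationCenter η μ.j n) := by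
  obtain ⟨n, hn, hle⟩ := h.exists_orientation_le
  refine (one_le_mul_latticeWeight hle).trans ?_
  gcongr
  exact Finset.single_le_sum (f := fun n => latticeWeight (μ.l - orientationCenter η μ.j n))
    (fun _ _ => zero_le) hn

theorem Overlap.one_le_shear {η : ShearletIndex} {μ : CurveletIndex} (h : Overlap η μ) :
    1 ≤ ENNReal.ofReal (1 + 219200 ^ 2) *
      (latticeWeight (η.k - shearCenter μ η.j η.cone) + latticeWeight (η.k - 0)) := by
  rcases h.shear_le with hle | hle
  · exact (one_le_mul_latticeWeight hle).trans (by gcongr; exact le_self_add)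
  · rw [← sub_zero (η.k : ℝ)] at hle
    exact (one_le_mul_latticeWeight hle).trans (by gcongr; exact le_add_self)

theorem le_mul_of_one_le {x y a b c d : ℝ≥0∞} (h : x ≤ y) (h1 : 1 ≤ a * b) (h2 : 1 ≤ c * d) :
    x ≤ a * c * (b * d) * y := by
  calc x ≤ y := h
    _ = 1 * 1 * y := by simp
    _ ≤ (a * b) * (c * d) * y := by gcongr
    _ = a * c * (b * d) * y := by ring

theorem exists_row_sum_le {W V W' V' : ℝ → ℂ} (hW : IsRadialWindow W)
    (hV : IsDirectionalWindow V) (hW' : IsRadialWindow W') (hV' : IsDirectionalWindow V') {p : ℝ}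
    (hp : 0 < p) :
    ∃ B : ℝ≥0∞, B ≠ ⊤ ∧ ∀ η : ShearletIndex, ∑' μ : CurveletIndex,
      ‖l2Inner (shearlet W V η) (curvelet W' V' μ)‖ₑ ^ p ≤ B := by
  obtain ⟨N, hN⟩ : ∃ N : ℕ, 4 ≤ N * p := by
    obtain ⟨N, hN⟩ := exists_nat_ge (4 / p)
    exact ⟨N, (div_le_iff₀ hp).1 hN⟩
  obtain ⟨C, hC, hb⟩ := exists_crossGramian_bound hW hV hW' hV' N
  obtain ⟨Z, hZ, hZb⟩ := exists_tsum_latticeWeight_le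
  refine ⟨ENNReal.ofReal (1 + 6 ^ 2) * ENNReal.ofReal (1 + 1370 ^ 2) * ENNReal.ofReal (C ^ p) *
    (Z * (7 * Z) * (Z * Z)), by finiteness, fun η => ?_⟩
  let f : ℕ → ℝ≥0∞ := fun j => latticeWeight (j - η.j)
  let g : ℕ → ℕ → ℝ≥0∞ := fun j l =>
    ∑ n ∈ Finset.Icc (-3 : ℤ) 3, latticeWeight (l - orientationCenter η j n)
  -- For a fixed shearlet, scale and orientation the offset is `m + c`, so the position sum runs
  -- over a translate of `ℤ²`.
  let c : ℕ → ℕ → Plane := fun j l => matAct (transition η.j η.k η.cone j l) (latticePoint η.m)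
  let h : ℕ → ℕ → ℤ × ℤ → ℝ≥0∞ := fun j l m =>
    latticeWeight (m.1 - -(c j l 0)) * latticeWeight (m.2 - -(c j l 1))
  have hinj : Function.Injective
      (fun μ : CurveletIndex => ((μ.j, μ.l, μ.m) : ℕ × ℕ × (ℤ × ℤ))) := by
    rintro ⟨⟩ ⟨⟩ h
    simp_all
  calc ∑' μ : CurveletIndex, ‖l2Inner (shearlet W V η) (curvelet W' V' μ)‖ₑ ^ p
      ≤ ∑' μ : CurveletIndex, ENNReal.ofReal (1 + 6 ^ 2) * ENNReal.ofReal (1 + 1370 ^ 2) *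
          ENNReal.ofReal (C ^ p) * (f μ.j * g μ.j μ.l * h μ.j μ.l μ.m) := by
        refine ENNReal.tsum_le_tsum fun μ => ?_
        rcases hb η μ with h0 | ⟨ho, hle⟩
        · rw [h0, enorm_zero, ENNReal.zero_rpow_of_pos hp]
          exact zero_le
        · refine (le_mul_of_one_le (enorm_rpow_le_latticeWeight hC hp hN hle) ho.one_le_scale
            ho.one_le_orientation).trans (le_of_eq ?_)
          simp only [f, g, h, c, offset, sub_neg_eq_add, PiLp.add_apply, latticePoint]
          simp only [Matrix.cons_val_zero, Matrix.cons_val_one]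
          ring
    _ = ENNReal.ofReal (1 + 6 ^ 2) * ENNReal.ofReal (1 + 1370 ^ 2) * ENNReal.ofReal (C ^ p) *
          ∑' μ : CurveletIndex, f μ.j * g μ.j μ.l * h μ.j μ.l μ.m := ENNReal.tsum_mul_left
    _ ≤ _ := by
        gcongr
        refine (ENNReal.tsum_comp_le_tsum_of_injective hinj
          (fun i : ℕ × ℕ × (ℤ × ℤ) => f i.1 * g i.1 i.2.1 * h i.1 i.2.1 i.2.2)).trans ?_
        refine tsum_triple_le f g h ?_ ?_ ?_
        · exact (tsum_nat_latticeWeight_le _).trans (hZb _)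
        · intro j
          simp only [g]
          rw [Summable.tsum_finsetSum fun _ _ => ENNReal.summable]
          calc _ ≤ ∑ n ∈ Finset.Icc (-3 : ℤ) 3, Z :=
                Finset.sum_le_sum fun n _ => (tsum_nat_latticeWeight_le _).trans (hZb _)
            _ = 7 * Z := by simp
        · intro j l
          simp only [h]
          rw [tsum_prod_latticeWeight]
          gcongr <;> exact hZb _

theorem exists_column_sum_le {W V W' V' : ℝ → ℂ} (hW : IsRadialWindow W)
    (hV : IsDirectionalWindow V) (hW' : IsRadialWindow W') (hV' : IsDirectionalWindow V') {p : ℝ}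
    (hp : 0 < p) :
    ∃ B : ℝ≥0∞, B ≠ ⊤ ∧ ∀ μ : CurveletIndex, ∑' η : ShearletIndex,
      ‖l2Inner (shearlet W V η) (curvelet W' V' μ)‖ₑ ^ p ≤ B := by
  obtain ⟨N, hN⟩ : ∃ N : ℕ, 4 ≤ N * p := by
    obtain ⟨N, hN⟩ := exists_nat_ge (4 / p)
    exact ⟨N, (div_le_iff₀ hp).1 hN⟩
  obtain ⟨C, hC, hb⟩ := exists_crossGramian_bound hW hV hW' hV' N
  obtain ⟨Z, hZ, hZb⟩ := exists_tsum_latticeWeight_le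
  refine ⟨ENNReal.ofReal (1 + 6 ^ 2) * ENNReal.ofReal (1 + 219200 ^ 2) *
    ENNReal.ofReal ((C * 350721 ^ N) ^ p) * (2 * Z * (Z + Z) * (Z * Z)), by finiteness,
    fun μ => ?_⟩
  -- The cone is bundled with the scale, since the shear centre depends on both; it contributes the
  -- factor `2`.
  let f : ℕ × Fin 2 → ℝ≥0∞ := fun a => latticeWeight (a.1 - μ.j)
  let g : ℕ × Fin 2 → ℤ → ℝ≥0∞ := fun a k =>
    latticeWeight (k - shearCenter μ a.1 a.2) + latticeWeight (k - 0)
  let c : ℕ × Fin 2 → ℤ → Plane := fun a k =>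
    matAct (transition a.1 k a.2 μ.j μ.l)⁻¹ (latticePoint μ.m)
  let h : ℕ × Fin 2 → ℤ → ℤ × ℤ → ℝ≥0∞ := fun a k m =>
    latticeWeight (m.1 - -(c a k 0)) * latticeWeight (m.2 - -(c a k 1))
  have hinj : Function.Injective
      (fun η : ShearletIndex => (((η.j, η.cone), η.k, η.m) : (ℕ × Fin 2) × ℤ × (ℤ × ℤ))) := by
    rintro ⟨⟩ ⟨⟩ h
    simp_all
  calc ∑' η : ShearletIndex, ‖l2Inner (shearlet W V η) (curvelet W' V' μ)‖ₑ ^ p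
      ≤ ∑' η : ShearletIndex, ENNReal.ofReal (1 + 6 ^ 2) * ENNReal.ofReal (1 + 219200 ^ 2) *
          ENNReal.ofReal ((C * 350721 ^ N) ^ p) *
          (f (η.j, η.cone) * g (η.j, η.cone) η.k * h (η.j, η.cone) η.k η.m) := by
        refine ENNReal.tsum_le_tsum fun η => ?_
        rcases hb η μ with h0 | ⟨ho, hle⟩
        · rw [h0, enorm_zero, ENNReal.zero_rpow_of_pos hp]
          exact zero_le
        · have hle' : ‖l2Inner (shearlet W V η) (curvelet W' V' μ)‖ ≤ C * 350721 ^ N *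
              ((1 + ‖latticePoint η.m +
                matAct (transition η.j η.k η.cone μ.j μ.l)⁻¹ (latticePoint μ.m)‖) ^ N)⁻¹ := by
            refine hle.trans ?_
            rw [mul_assoc]
            gcongr
            rw [← div_eq_mul_inv, le_div_iff₀ (by positivity), inv_mul_le_iff₀ (by positivity),
              ← mul_pow, mul_comm (1 + ‖offset η μ‖)]
            exact pow_le_pow_left₀ (by positivity) (one_add_norm_le_of_transition ho) N
          refine (le_mul_of_one_le (enorm_rpow_le_latticeWeight (by positivity) hp hN hle')
            (latticeWeight_sub_comm μ.j η.j ▸ ho.one_le_scale) ho.one_le_shear).trans (le_of_eq ?_)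
          simp only [f, g, h, c, sub_neg_eq_add, PiLp.add_apply, latticePoint]
          simp only [Matrix.cons_val_zero, Matrix.cons_val_one]
          ring
    _ = ENNReal.ofReal (1 + 6 ^ 2) * ENNReal.ofReal (1 + 219200 ^ 2) *
          ENNReal.ofReal ((C * 350721 ^ N) ^ p) * ∑' η : ShearletIndex,
            f (η.j, η.cone) * g (η.j, η.cone) η.k * h (η.j, η.cone) η.k η.m :=
        ENNReal.tsum_mul_left
    _ ≤ _ := by
        gcongr
        refine (ENNReal.tsum_comp_le_tsum_of_injective hinj
          (fun i : (ℕ × Fin 2) × ℤ × (ℤ × ℤ) =>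
            f i.1 * g i.1 i.2.1 * h i.1 i.2.1 i.2.2)).trans ?_
        refine tsum_triple_le f g h ?_ ?_ ?_
        · rw [ENNReal.tsum_prod']
          simp only [f, tsum_fintype, Finset.sum_const, Finset.card_univ, Fintype.card_fin,
            nsmul_eq_mul, ENNReal.tsum_mul_left]
          push_cast
          gcongr
          exact (tsum_nat_latticeWeight_le _).trans (hZb _)
        · intro a
          simp only [g]
          rw [ENNReal.tsum_add]
          gcongr <;> exact hZb _
        · intro a k
          simp only [h]
          rw [tsum_prod_latticeWeight]
          gcongr <;> exact hZb _

end

theorem theorem1 (W V : ℝ → ℂ) (hW : IsRadialWindow W) (hV : IsDirectionalWindow V)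
    (W' V' : ℝ → ℂ) (hW' : IsRadialWindow W') (hV' : IsDirectionalWindow V') :
    (∀ η : ShearletIndex, MemLp (shearlet W V η) 2 volume) ∧
    (∀ μ : CurveletIndex, MemLp (curvelet W' V' μ) 2 volume) ∧
    ∀ p : ℝ, 0 < p → p ≤ 1 →
      opNormP p (fun (η : ShearletIndex) (μ : CurveletIndex) =>
        l2Inner (shearlet W V η) (curvelet W' V' μ)) < ∞ := by
  refine ⟨fun η => ?_, fun μ => ?_, fun p hp _ => ?_⟩
  · rw [shearlet_eq]
    exact memLp_affine (shearletMatrix_transpose_mul (aspect_pos η.j) η.k η.cone) _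
      (contDiff_shearletProfile hW hV) (hasCompactSupport_shearletProfile hW hV) _
  · rw [curvelet_eq hW' hV']
    exact memLp_affine
      (curveletMatrix_transpose_mul (aspect_pos μ.j) (curveletAngle μ.j μ.l)) _
      (contDiff_curveletProfile_slice hW' hV' _) (hasCompactSupport_curveletProfile_slice W' V' _) _
  · obtain ⟨B, hB, hrow⟩ := exists_row_sum_le hW hV hW' hV' hp
    obtain ⟨D, hD, hcol⟩ := exists_column_sum_le hW hV hW' hV' hp
    rw [opNormP]
    refine max_lt ?_ ?_
    · exact ENNReal.rpow_lt_top_of_nonneg (by positivity) ((iSup_le hrow).trans_lt hB.lt_top).ne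
    · exact ENNReal.rpow_lt_top_of_nonneg (by positivity) ((iSup_le hcol).trans_lt hD.lt_top).ne
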